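/- Let $t\ge 1$ and let $p_1,\dots,p_t$ be distinct primes with $p_i\equiv 1\pmod 4$ for $1\le i\le t-1$ and $p_t\equiv 3\pmod 4$. Put $\Delta=-p_1\cdots p_t$, $F=\mathbb{Q}(\sqrt{\Delta})$, and let $\mathscr{C}$ be the class group of $F$, written additively. Let $r_8=\dim_{\mathbb{F}_2}4\mathscr{C}/8\mathscr{C}$ be its $8$-rank. Let $V'$ be the $\mathbb{F}_2$-vector space of positive divisors of $p_1\cdots p_{t-1}$ with addition $(D_1,D_2)\mapsto D_1D_2/\gcd(D_1,D_2)^2$. For $1\le i\le t$ let $\mathfrak{p}_i$ be the prime ideal of $F$ with $\mathfrak{p}_i^2=(p_i)$, and let $V_0\subset V'$ be the subspace of those $D$ for which the class of $\prod_{p_i\mid D}\mathfrak{p}_i$ lies in $2\mathscr{C}$ (so $V_0$ corresponds to $\mathscr{C}[2]\cap 2\mathscr{C}$). For a prime $p\equiv 1\pmod 4$ and a quadratic residue $a$ modulo $p$ with $p\nmid a$, let $\left(\frac{a}{p}\right)_4=\pm1$ be the sign congruent to $a^{(p-1)/4}$ modulo $p$, and put $\left(\frac{a}{D}\right)_4=\prod_{p\mid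 D}\left(\frac{a}{p}\right)_4$ for a squarefree product $D$ of such primes. Let $\xi\colon\{\pm1\}\to\mathbb{F}_2$ be the group isomorphism. For a quadratic form $Q$ on a finite-dimensional vector space $W$, let the isotropy index $\rho(Q)$ be the maximal dimension of a subspace $W'\subset W$ with $Q|_{W'}=0$. Then for every $D\in V_0$ and every prime $p\mid D$ the integer $\Delta/D$ is prime to $p$ and a quadratic residue modulo $p$, the map $$Q_{\mathfrak{B}}\colon V_0\to\mathbb{F}_2,\qquad Q_{\mathfrak{B}}(D)=\xi\left(\left(\frac{\Delta/D}{D}\right)_4\right)$$ is a quadratic form on $V_0$, and $$r_8\le\rho(Q_{\mathfrak{B}}).$$ Consequently, $r_8\le\log_2\#Q_{\mathfrak{B}}^{-1}(0)$. -/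

import Mathlib

open scoped NumberField

noncomputable section

/-- The subgroup of `m`-th powers of a commutative group (written `mG` in additive notation). -/
def powSubgroup (G : Type*) [CommGroup G] (m : ℕ) : Subgroup G :=
  (powMonoidHom m : G →* G).range

/-- The group `2 ^ (k - 1) G / 2 ^ k G`, written additively. -/
abbrev TwoPowQuotient (G : Type*) [CommGroup G] (k : ℕ) : Type _ :=
  Additive (powSubgroup G (2 ^ (k - 1)) ⧸
    (powSubgroup G (2 ^ k)).subgroupOf (powSubgroup G (2 ^ (k - 1))))

theorem two_nsmul_twoPowQuotient (G : Type*) [CommGroup G] (k : ℕ)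
    (x : TwoPowQuotient G k) : 2 • x = 0 := by
  obtain ⟨y, hy⟩ := QuotientGroup.mk_surjective x.toMul
  obtain ⟨⟨_, ⟨g, rfl⟩⟩, hg⟩ : ∃ z : powSubgroup G (2 ^ (k - 1)), z = y := ⟨y, rfl⟩
  apply Additive.toMul.injective
  change x.toMul ^ 2 = 1
  rw [← hy, ← QuotientGroup.mk_pow, QuotientGroup.eq_one_iff, Subgroup.mem_subgroupOf, ← hg]
  rcases k with _ | k
  · exact ⟨g ^ 2, by simp⟩
  · exact ⟨g, by simp [pow_succ, pow_mul]⟩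

instance twoPowQuotientModule (G : Type*) [CommGroup G] (k : ℕ) : Module (ZMod 2) (TwoPowQuotient G k) :=
  AddCommGroup.zmodModule (two_nsmul_twoPowQuotient G k)

/-- The `2 ^ k`-rank (`1 ≤ k`) of a commutative group `G`:
the dimension of `2 ^ (k - 1) G / 2 ^ k G` over `𝔽₂`. -/
def twoPowRank (G : Type*) [CommGroup G] (k : ℕ) : ℕ :=
  Module.finrank (ZMod 2) (TwoPowQuotient G k)

/-- The isotropy index of a quadratic form on a finite-dimensional space: the largest dimension
of a subspace on which the form vanishes identically. -/
def isotropyIndex {k W : Type*} [Field k] [AddCommGroup W] [Module k W]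
    (Q : QuadraticForm k W) : ℕ :=
  sSup {d : ℕ | ∃ U : Submodule k W, (∀ x ∈ U, Q x = 0) ∧ Module.finrank k U = d}

/-- `a` is prime to `q` and is a quadratic residue modulo `q`. -/
def IsQuadraticResidue (a : ℤ) (q : ℕ) : Prop :=
  (a : ZMod q) ≠ 0 ∧ IsSquare (a : ZMod q)

/-- The rational quartic symbol `(a / q)₄` for a prime `q ≡ 1 mod 4` and a quadratic residue `a`
modulo `q`: the sign congruent to `a ^ ((q - 1) / 4)` modulo `q`. -/
def quarticSymbol (a : ℤ) (q : ℕ) : ℤˣ :=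
  if (a : ZMod q) ^ ((q - 1) / 4) = 1 then 1 else -1

/-- The quartic symbol `(a / D)₄` for a squarefree product `D` of primes congruent to 1 mod 4. -/
def quarticSymbolProd (a : ℤ) (D : ℕ) : ℤˣ :=
  ∏ q ∈ D.primeFactors, quarticSymbol a q

/-- The isomorphism from `{1, -1}` to `𝔽₂`. -/
def signToF2 (u : ℤˣ) : ZMod 2 := if u = 1 then 0 else 1

/-- The discriminant `-p₁ ⋯ pₜ`, where `t = n + 1`. -/
def disc {n : ℕ} (p : Fin (n + 1) → ℕ) : ℤ := -∏ i, (p i : ℤ)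

/-- The positive divisor of `p₁ ⋯ pₜ₋₁` with coordinate vector `v`. The vector space of these
divisors, with sum `D₁ D₂ / gcd(D₁, D₂) ^ 2` and basis `p₁, …, pₜ₋₁`, is identified in this way
with `𝔽₂ ^ (t - 1)`. -/
def toDivisor {n : ℕ} (p : Fin (n + 1) → ℕ) (v : Fin n → ZMod 2) : ℕ :=
  ∏ i : Fin n, p i.castSucc ^ (v i).val

variable (F : Type*) [Field F] [NumberField F]

/-- For a prime `q` ramified in the quadratic field `F`, so that `(q) = 𝔮 ^ 2`, the radical of
`(q)` is the prime ideal `𝔮`. -/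
def primeAbove (q : ℕ) : Ideal (𝓞 F) := (Ideal.span {(q : 𝓞 F)}).radical

theorem primeAbove_mem {q : ℕ} (hq : q ≠ 0) :
    primeAbove F q ∈ nonZeroDivisors (Ideal (𝓞 F)) := by
  rw [mem_nonZeroDivisors_iff_ne_zero]
  intro h
  have h1 : (q : 𝓞 F) ∈ primeAbove F q :=
    Ideal.le_radical (Ideal.subset_span (Set.mem_singleton _))
  rw [h] at h1
  exact hq (by exact_mod_cast (Ideal.mem_bot.1 h1))

/-- The class of `primeAbove F q` (for `q ≠ 0`). -/
def primeClass (q : ℕ) : ClassGroup (𝓞 F) :=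
  if hq : q ≠ 0 then ClassGroup.mk0 ⟨primeAbove F q, primeAbove_mem F hq⟩ else 1

/-- The class of the ideal `∏ 𝔭ᵢ ^ vᵢ`, whose square is generated by `toDivisor p v`. -/
def divisorClass {n : ℕ} (p : Fin (n + 1) → ℕ) (v : Fin n → ZMod 2) : ClassGroup (𝓞 F) :=
  ∏ i : Fin n, primeClass F (p i.castSucc) ^ (v i).val

theorem divisorClass_add {n : ℕ} (p : Fin (n + 1) → ℕ) (v w : Fin n → ZMod 2) :
    ∃ c, divisorClass F p (v + w) * c ^ 2 = divisorClass F p v * divisorClass F p w := by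
  refine ⟨∏ i : Fin n, primeClass F (p i.castSucc) ^ (((v i).val + (w i).val) / 2), ?_⟩
  unfold divisorClass
  rw [← Finset.prod_pow, ← Finset.prod_mul_distrib, ← Finset.prod_mul_distrib]
  refine Finset.prod_congr rfl fun i _ => ?_
  rw [← pow_mul, ← pow_add, ← pow_add, Pi.add_apply, ZMod.val_add]
  congr 1
  omega

/-- The space `V₀ = C[2] ∩ 2C`, as the space of those divisors `D` of `p₁ ⋯ pₜ₋₁` (in coordinates)
for which the class of the ideal whose square is `(D)` is a square in the class group. -/
def V₀ {n : ℕ} (p : Fin (n + 1) → ℕ) : Submodule (ZMod 2) (Fin n → ZMod 2) :=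
  AddSubgroup.toZModSubmodule 2
    { carrier := {v | divisorClass F p v ∈ powSubgroup (ClassGroup (𝓞 F)) 2}
      zero_mem' := ⟨1, by simp [divisorClass]⟩
      add_mem' := by
        intro v w hv hw
        obtain ⟨c, hc⟩ := divisorClass_add F p v w
        have h : c ^ 2 ∈ powSubgroup (ClassGroup (𝓞 F)) 2 := ⟨c, rfl⟩
        exact (Subgroup.mul_mem_cancel_right _ h).1 (hc ▸ mul_mem hv hw)
      neg_mem' := by
        intro v hv
        rwa [show -v = v from funext fun i => ZModModule.neg_eq_self (v i)] }

end

/-! ### Quadratic and quartic symbols -/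

section Symbols

open NumberTheorySymbols

/-! For a divisor $D$ write $\mathfrak d$ for the ideal with $\mathfrak d^2=(D)$, and put
$a=\Delta/D$. If $D\in V_0$, some ideal $J$ prime to $2\Delta$ makes $\mathfrak dJ^2=(\alpha)$
principal. With $2\alpha=Dx+y\sqrt\Delta$ and $z=NJ$, taking norms gives $Dx^2-ay^2=4z^2$. Modulo a
prime $q\mid D$ this reads $ay^2\equiv-4z^2$, so $a$ is a square. Since $-4=(1+i)^4$ is a fourth
power modulo $q$, it also gives $(a/D)_4=(y/D)(z/D)$. Quadratic reciprocity yields $(y/D)=1$ when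
$y$ and $z$ are coprime, and the general case reduces to that one. Hence $(a/D)_4=(NJ/D)$: this is
`QuadraticConj.quarticSymbolProd_of_isPrincipal`.

The symbol $(NJ/D)$ is multiplicative in $J$ and in $D$ separately, and $JK$ serves for $D_1+D_2$
when $J$ serves for $D_1$ and $K$ for $D_2$. So the polar form is biadditive and $Q_{\mathfrak B}$
is quadratic. If the class of $\mathfrak d$ is a fourth power, $J$ may be taken to be a square. Then
$NJ$ is a square and $Q_{\mathfrak B}(D)=0$ (`quarticForm_eq_zero`).

It remains to see that the subspace of such $D$ has dimension at least $r_8$. By duality of kernel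
and cokernel of squaring, $\mathscr C[2]\cap4\mathscr C$ has $2^{r_8}$ elements
(`two_pow_twoPowRank`). By ambiguous class theory every class of order dividing 2 comes from some
$\mathfrak d$ (`QuadraticConj.exists_divisorClass_eq`). -/

theorem jacobiSym_prod_right {ι : Type*} (a : ℤ) (s : Finset ι) (f : ι → ℕ)
    (hf : ∀ i ∈ s, f i ≠ 0) : J(a | ∏ i ∈ s, f i) = ∏ i ∈ s, J(a | f i) := by
  classical
  induction s using Finset.induction_on with
  | empty => simp
  | insert i s hi ih =>
    rw [Finset.prod_insert hi, Finset.prod_insert hi,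
      jacobiSym.mul_right' _ (hf i (by simp))
        (Finset.prod_ne_zero_iff.2 fun j hj => hf j (by simp [hj])),
      ih fun j hj => hf j (by simp [hj])]

theorem jacobiSym_eq_prod_primeFactors (a : ℤ) {D : ℕ} (hD : Squarefree D) :
    J(a | D) = ∏ q ∈ D.primeFactors, J(a | q) := by
  conv_lhs => rw [← Nat.prod_primeFactors_of_squarefree hD]
  exact jacobiSym_prod_right a _ _ fun q hq => (Nat.prime_of_mem_primeFactors hq).ne_zero

/-- Raise the congruence to the power $(q-1)/4$: the squares of $y$ and $z$ become Legendre symbols,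
and $-4$ contributes $1$. -/
theorem quarticSymbol_mul_legendreSym {q : ℕ} [Fact q.Prime] (hq : q % 4 = 1) {a y z : ℤ}
    (h : (a : ZMod q) * (y : ZMod q) ^ 2 = -4 * (z : ZMod q) ^ 2)
    (hy : (y : ZMod q) ≠ 0) (hz : (z : ZMod q) ≠ 0) :
    (quarticSymbol a q : ℤ) * legendreSym q y = legendreSym q z := by
  have hq2 : q ≠ 2 := by rintro rfl; simp at hq
  have : Fact (2 < q) := ⟨lt_of_le_of_ne (Fact.out : q.Prime).two_le hq2.symm⟩
  obtain ⟨m, rfl⟩ : ∃ m, q = 4 * m + 1 := ⟨q / 4, by omega⟩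
  set q := 4 * m + 1
  have e4 : (q - 1) / 4 = m := by omega
  have e2 : q / 2 = 2 * m := by omega
  have h2 : ((2 : ℤ) : ZMod q) ≠ 0 := by
    intro h0
    have := (ZMod.intCast_zmod_eq_zero_iff_dvd 2 q).1 h0
    have := Int.le_of_dvd (by norm_num) this
    have : 2 < q := Fact.out
    omega
  -- $(-4)^m=(-1)^m2^{2m}=(-1)^m(2/q)$, and $(2/q)=(-1)^m$ for $q=4m+1$.
  have hm4 : (-4 : ZMod q) ^ m = 1 := by
    have hchi : (legendreSym q (-1) : ZMod q) = 1 := by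
      rw [legendreSym.at_neg_one hq2, ZMod.χ₄_nat_one_mod_four hq]; simp
    have e : legendreSym q 2 = (-1) ^ m := by
      rw [legendreSym.at_two hq2, ZMod.χ₈_nat_eq_if_mod_eight]
      rcases Nat.even_or_odd' m with ⟨k, hk | hk⟩
      · rw [if_neg (by omega), if_pos (by omega), hk, pow_mul]; simp
      · rw [if_neg (by omega), if_neg (by omega), hk, pow_succ, pow_mul]; simp
    have e' := legendreSym.eq_pow q 2
    rw [e, e2] at e'
    have : (-4 : ZMod q) = (-1) * 2 ^ 2 := by norm_num
    rw [this, mul_pow, ← pow_mul]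
    push_cast at e'
    rw [← e', ← pow_add, ← two_mul, pow_mul]
    simp
  have key : (a : ZMod q) ^ m * (legendreSym q y : ZMod q) = (legendreSym q z : ZMod q) := by
    rw [legendreSym.eq_pow, legendreSym.eq_pow, e2, pow_mul, pow_mul, ← mul_pow, h, mul_pow, hm4,
      one_mul]
  have n1 : (1 : ZMod q) ≠ -1 := (ZMod.neg_one_ne_one).symm
  unfold quarticSymbol
  rw [e4]
  rcases legendreSym.eq_one_or_neg_one q hy with ey | ey <;>
  rcases legendreSym.eq_one_or_neg_one q hz with ez | ez <;>
  rw [ey, ez] at key ⊢ <;> push_cast at key <;> split_ifs with h1 <;> simp_all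

/-- Write $y=2^kw$ with $w$ odd. Modulo $w$, $Dx^2$ is the square $(2z)^2$ of a unit, so $(D/w)=1$,
and reciprocity with $D\equiv1\pmod 4$ gives $(w/D)=1$. The power of 2 is settled by congruences
modulo 8. -/
theorem jacobiSym_eq_one_of_eq {D y : ℕ} {E x z : ℤ} (hD : D % 4 = 1) (hE : E % 4 = 3)
    (h : D * x ^ 2 + E * y ^ 2 = 4 * z ^ 2) (hz : z % 2 = 1) (hy : y ≠ 0)
    (hyz : IsCoprime (y : ℤ) z) : J((y : ℤ) | D) = 1 := by
  have hDodd : Odd D := Nat.odd_iff.2 (by omega)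
  obtain ⟨k, w, hw, rfl⟩ := Nat.exists_eq_two_pow_mul_odd hy
  have hodd : J((w : ℤ) | D) = 1 := by
    rw [← jacobiSym.quadratic_reciprocity_one_mod_four hD hw]
    have hwc : IsCoprime (w : ℤ) (2 * z) := by
      refine IsCoprime.mul_right ?_ (hyz.of_isCoprime_of_dvd_left ⟨2 ^ k, by push_cast; ring⟩)
      exact_mod_cast Nat.isCoprime_iff_coprime.2 hw.coprime_two_right
    have hg : (2 * z).gcd w = 1 := Int.isCoprime_iff_gcd_eq_one.1 hwc.symm
    have e : J(D * x ^ 2 | w) = 1 := by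
      rw [← jacobiSym.sq_one' hg]
      apply jacobiSym.mod_left'
      apply Int.ModEq.symm
      rw [Int.modEq_iff_dvd]
      refine ⟨-(E * (2 ^ k) ^ 2 * w), ?_⟩
      push_cast at h
      linear_combination h
    rw [jacobiSym.mul_left, jacobiSym.pow_left] at e
    rcases jacobiSym.trichotomy x w with hx | hx | hx <;> simp_all
  push_cast
  rw [jacobiSym.mul_left, hodd, mul_one, jacobiSym.pow_left]
  rcases k with _ | k
  · simp
  have hD4 : ∃ d, (D : ℤ) = 4 * d + 1 := ⟨D / 4, by omega⟩
  obtain ⟨d, hd⟩ := hD4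
  obtain ⟨e, rfl⟩ : ∃ e, E = 4 * e + 3 := ⟨E / 4, by omega⟩
  have sq8 : ∀ t : ℤ, Odd t → ∃ s, t ^ 2 = 8 * s + 1 := fun t ht => by
    obtain ⟨s, hs⟩ := Int.eight_dvd_sq_sub_one_of_odd ht
    exact ⟨s, by linarith⟩
  obtain ⟨c, hc⟩ := sq8 z (Int.odd_iff.2 hz)
  have hx : Even x := by
    by_contra hx
    rw [Int.not_even_iff_odd] at hx
    have : Odd ((D : ℤ) * x ^ 2) := (by exact_mod_cast hDodd : Odd (D : ℤ)).mul hx.pow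
    have h2 : Even ((D : ℤ) * x ^ 2) := by
      rw [eq_sub_of_add_eq h]
      refine Even.sub ⟨2 * z ^ 2, by ring⟩ ⟨(4 * e + 3) * 2 ^ (2 * k + 1) * w ^ 2, by
        push_cast; ring⟩
    exact Int.not_even_iff_odd.2 this h2
  obtain ⟨u, rfl⟩ := hx
  have h' : (4 * d + 1) * u ^ 2 + (4 * e + 3) * (2 ^ k * w) ^ 2 = 8 * c + 1 := by
    rw [← hc, ← hd]
    push_cast at h
    have : (4 : ℤ) * (D * u ^ 2 + (4 * e + 3) * (2 ^ k * w) ^ 2) = 4 * z ^ 2 := by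
      rw [← h]; ring
    linarith
  -- Here $y=2^{k+1}w$ and $x=2u$. The case $k=0$ contradicts the equation modulo 4; for $k=1$ the
  -- factor is $(4/D)=1$; for $k\ge2$ the number $u$ is odd, forcing $D\equiv1\pmod 8$ and
  -- $(2/D)=1$.
  rcases k with _ | _ | k
  · exfalso
    obtain ⟨s, hs⟩ := sq8 w (by exact_mod_cast hw)
    rcases Int.even_or_odd' u with ⟨r, rfl | rfl⟩ <;> ring_nf at h' hs <;> rw [hs] at h' <;>
      ring_nf at h' <;> omega
  · rw [← jacobiSym.pow_left]
    exact jacobiSym.at_four hDodd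
  · have hu : Odd u := by
      by_contra hu
      rw [Int.not_odd_iff_even] at hu
      obtain ⟨r, rfl⟩ := hu
      ring_nf at h'
      omega
    obtain ⟨s, hs⟩ := sq8 u hu
    have hD8 : D % 8 = 1 := by
      rw [hs] at h'
      ring_nf at h'
      omega
    rw [jacobiSym.at_two hDodd, ZMod.χ₈_nat_eq_if_mod_eight, if_neg (by omega), if_pos (by omega),
      one_pow]

theorem quarticSymbolProd_eq_jacobiSym {D y : ℕ} {a x z : ℤ} (hD : Squarefree D)
    (hD4 : ∀ q ∈ D.primeFactors, q % 4 = 1) (ha : a % 4 = 1)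
    (h : D * x ^ 2 - a * y ^ 2 = 4 * z ^ 2) (hz : z % 2 = 1) (hzD : IsCoprime z D) (hy : y ≠ 0)
    (hyz : IsCoprime (y : ℤ) z) : (quarticSymbolProd a D : ℤ) = J(z | D) := by
  have hDmod : D % 4 = 1 := by
    rw [← Nat.prod_primeFactors_of_squarefree hD, Finset.prod_nat_mod,
      Finset.prod_congr rfl hD4]
    simp
  have h1 : J((y : ℤ) | D) = 1 :=
    jacobiSym_eq_one_of_eq (E := -a) (x := x) hDmod (by omega) (by linarith) hz hy hyz
  rw [← mul_one (quarticSymbolProd a D : ℤ), ← h1, jacobiSym_eq_prod_primeFactors _ hD,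
    jacobiSym_eq_prod_primeFactors _ hD, quarticSymbolProd, Units.coe_prod,
    ← Finset.prod_mul_distrib]
  refine Finset.prod_congr rfl fun q hq => ?_
  have hqp := Nat.prime_of_mem_primeFactors hq
  have hqD : (q : ℤ) ∣ D := Int.natCast_dvd_natCast.2 (Nat.dvd_of_mem_primeFactors hq)
  have := Fact.mk hqp
  have hq4 := hD4 q hq
  have hDq : (D : ZMod q) = 0 := by
    exact_mod_cast (ZMod.intCast_zmod_eq_zero_iff_dvd D q).2 hqD
  have hzq : (z : ZMod q) ≠ 0 := fun h0 => by
    rw [ZMod.intCast_zmod_eq_zero_iff_dvd] at h0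
    exact Nat.prime_iff_prime_int.1 hqp |>.not_isUnit (hzD.isUnit_of_dvd' h0 hqD)
  have hmod : (a : ZMod q) * ((y : ℤ) : ZMod q) ^ 2 = -4 * (z : ZMod q) ^ 2 := by
    have := congrArg (Int.cast : ℤ → ZMod q) h
    push_cast at this ⊢
    rw [hDq] at this
    linear_combination -this
  have h4 : (-4 : ZMod q) ≠ 0 := fun h0 => by
    have h0' : ((-4 : ℤ) : ZMod q) = 0 := by exact_mod_cast h0
    rw [ZMod.intCast_zmod_eq_zero_iff_dvd] at h0'
    have : (q : ℤ) ∣ (4 : ℕ) := by simpa using h0'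
    have := Nat.le_of_dvd (by norm_num) (Int.natCast_dvd_natCast.1 this)
    have := hqp.two_le
    omega
  have hyq : ((y : ℤ) : ZMod q) ≠ 0 := fun h0 => by
    rw [h0] at hmod
    have := mul_ne_zero h4 (pow_ne_zero 2 hzq)
    exact this (by rw [← hmod]; ring)
  rw [← jacobiSym.legendreSym.to_jacobiSym, ← jacobiSym.legendreSym.to_jacobiSym]
  exact quarticSymbol_mul_legendreSym hq4 hmod hyq hzq

end Symbols

/-! ### Conjugation in quadratic fields -/

section Conjugation

/-- The ring of integers of a quadratic field together with its conjugation, a square root `δ`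
of `Δ` and the integer `ω = (1 + δ) / 2`. -/
structure QuadraticConj (F : Type*) [Field F] [NumberField F] (Δ : ℤ) where
  /-- A square root of `Δ`. -/
  δ : 𝓞 F
  /-- Half of `1 + δ`. -/
  ω : 𝓞 F
  /-- The conjugation. -/
  σ : 𝓞 F ≃+* 𝓞 F
  δ_sq : δ ^ 2 = Δ
  two_mul_ω : 2 * ω = 1 + δ
  σ_δ : σ δ = -δ
  σ_σ : ∀ x, σ (σ x) = x
  exists_coords : ∀ x, ∃ a b : ℤ, 2 * x = a + b * δ
  mul_σ : ∀ x, x * σ x = (Algebra.norm ℤ x : ℤ)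

variable {F : Type*} [Field F] [NumberField F]

/-- The square of the denominator of $r$ must divide the squarefree $\Delta$. -/
theorem Rat.exists_int_of_sq_mul_squarefree {Δ : ℤ} (hΔ : Squarefree Δ) {r : ℚ} {m : ℤ}
    (h : r ^ 2 * Δ = m) : ∃ b : ℤ, r = b := by
  have hden : (r.den : ℚ) ≠ 0 := by exact_mod_cast r.den_nz
  have e : r.num ^ 2 * Δ = m * (r.den : ℤ) ^ 2 := by
    have : (r.num : ℚ) ^ 2 * Δ = m * (r.den : ℚ) ^ 2 := by
      rw [← h]
      nth_rw 2 [← Rat.num_div_den r]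
      field_simp
    exact_mod_cast this
  have hc : IsCoprime ((r.den : ℤ) ^ 2) (r.num ^ 2) := by
    refine IsCoprime.pow ?_
    rw [isCoprime_comm, Int.isCoprime_iff_gcd_eq_one]
    exact r.reduced
  have hd : (r.den : ℤ) * r.den ∣ Δ := by
    rw [← sq]
    exact hc.dvd_of_dvd_mul_left ⟨m, by rw [e]; ring⟩
  have hu := hΔ _ hd
  have : r.den = 1 := by simpa using Int.isUnit_iff_natAbs_eq.1 hu
  exact ⟨r.num, by conv_lhs => rw [← Rat.num_div_den r, this]; simp⟩

theorem exists_quadraticConj (hdeg : Module.finrank ℚ F = 2) {Δ : ℤ} (hΔ : Squarefree Δ)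
    (hΔ4 : Δ % 4 = 1) (hΔ0 : Δ < 0) (hs : ∃ s : F, s ^ 2 = (Δ : F)) :
    Nonempty (QuadraticConj F Δ) := by
  obtain ⟨s, hs⟩ := hs
  have : Algebra.IsQuadraticExtension ℚ F := ⟨hdeg⟩
  have hs0 : s ≠ 0 := by
    rintro rfl
    have : ((Δ : ℤ) : F) = 0 := by rw [← hs]; simp
    rw [Int.cast_eq_zero] at this
    omega
  have hint : ∀ x : F, ∀ y : 𝓞 F, x ^ 2 = y → IsIntegral ℤ x := fun x y h =>
    IsIntegral.of_pow (n := 2) (by norm_num) (h ▸ y.2)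
  -- the conjugation
  obtain ⟨c, hc⟩ : ∃ c : Gal(F/ℚ), c s ≠ s := by
    by_contra! hall
    obtain ⟨r, hr⟩ := (IsGalois.mem_range_algebraMap_iff_fixed (F := ℚ) s).2 hall
    have : (algebraMap ℚ F) (r ^ 2) = algebraMap ℚ F Δ := by rw [map_pow, hr, hs]; simp
    have h2 := (algebraMap ℚ F).injective this
    have h3 : (Δ : ℚ) < 0 := by exact_mod_cast hΔ0
    nlinarith [sq_nonneg r]
  have hcs : c s = -s := by
    have : (c s) ^ 2 = s ^ 2 := by rw [← map_pow, hs]; simp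
    exact (sq_eq_sq_iff_eq_or_eq_neg.1 this).resolve_left hc
  have hc1 : c ≠ 1 := by rintro rfl; exact hc rfl
  classical
  have huniv : (Finset.univ : Finset Gal(F/ℚ)) = {1, c} := by
    symm
    apply Finset.eq_univ_of_card
    rw [Finset.card_pair hc1.symm, ← Nat.card_eq_fintype_card, IsGalois.card_aut_eq_finrank, hdeg]
  have hfix : ∀ x : F, c x = x → ∃ r : ℚ, (r : F) = x := by
    intro x hx
    obtain ⟨r, hr⟩ := (IsGalois.mem_range_algebraMap_iff_fixed (F := ℚ) x).2 fun f => by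
      have : f ∈ ({1, c} : Finset Gal(F/ℚ)) := huniv ▸ Finset.mem_univ f
      rcases Finset.mem_insert.1 this with rfl | h
      · rfl
      · rw [Finset.mem_singleton.1 h, hx]
    exact ⟨r, by simpa using hr⟩
  have hcc : ∀ x, c (c x) = x := by
    have : c * c ∈ ({1, c} : Finset Gal(F/ℚ)) := huniv ▸ Finset.mem_univ _
    rcases Finset.mem_insert.1 this with h | h
    · exact fun x => DFunLike.congr_fun h x
    · exact absurd (mul_eq_left.1 (Finset.mem_singleton.1 h)) hc1
  have hnorm : ∀ x : F, x * c x = (Algebra.norm ℚ x : F) := fun x => by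
    have := Algebra.norm_eq_prod_automorphisms ℚ x
    rw [huniv, Finset.prod_pair hc1.symm] at this
    simpa using this.symm
  have htrace : ∀ x : F, x + c x = (Algebra.trace ℚ F x : F) := fun x => by
    have := trace_eq_sum_automorphisms (K := ℚ) x
    rw [huniv, Finset.sum_pair hc1.symm] at this
    simpa using this.symm
  have hsint : IsIntegral ℤ s := hint s (Δ : 𝓞 F) (by rw [hs]; simp)
  obtain ⟨k, hk⟩ : ∃ k, Δ = 4 * k + 1 := ⟨Δ / 4, by omega⟩
  have hwint : IsIntegral ℤ ((1 + s) / 2) := by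
    refine ⟨Polynomial.X ^ 2 - Polynomial.X - Polynomial.C k, ?_, ?_⟩
    · monicity!
    · simp only [Polynomial.eval₂_sub, Polynomial.eval₂_pow, Polynomial.eval₂_X,
        Polynomial.eval₂_C]
      have : s ^ 2 = 4 * k + 1 := by rw [hs, hk]; push_cast; ring
      field_simp
      simp only [eq_intCast]
      linear_combination this
  refine ⟨⟨⟨s, hsint⟩, ⟨_, hwint⟩, NumberField.RingOfIntegers.mapRingEquiv c.toRingEquiv,
    ?_, ?_, ?_, ?_, ?_, ?_⟩⟩
  · apply NumberField.RingOfIntegers.ext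
    change s ^ 2 = ((Δ : 𝓞 F) : F)
    simpa using hs
  · apply NumberField.RingOfIntegers.ext
    change 2 * ((1 + s) / 2) = 1 + s
    ring
  · apply NumberField.RingOfIntegers.ext
    exact hcs
  · intro x
    apply NumberField.RingOfIntegers.ext
    exact hcc x
  · intro x
    -- The second coordinate is $(x-\bar x)/\sqrt\Delta$, the first is the trace. The quotient is
    -- rational and its square times $\Delta$ is integral, so it is an integer.
    obtain ⟨r, hr⟩ := hfix ((x - c x) / s) (by
      rw [map_div₀, map_sub, hcc, hcs, div_neg, ← neg_div, neg_sub])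
    have hx : (x : F) - c x = r * s := by rw [hr]; field_simp
    obtain ⟨m, hm⟩ : ∃ m : ℤ, r ^ 2 * Δ = m := by
      have hI : IsIntegral ℤ ((algebraMap ℚ F) (r ^ 2 * Δ)) := by
        have : (algebraMap ℚ F) (r ^ 2 * Δ) = (x - c x) ^ 2 := by
          rw [hx, mul_pow, hs]; simp
        rw [this]
        exact (x.2.sub (x.2.map c.toRingEquiv.toRingHom.toIntAlgHom)).pow 2
      rw [isIntegral_algebraMap_iff (algebraMap ℚ F).injective] at hI
      obtain ⟨m, hm⟩ := IsIntegrallyClosed.isIntegral_iff.1 hI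
      exact ⟨m, by simpa using hm.symm⟩
    obtain ⟨b, rfl⟩ := Rat.exists_int_of_sq_mul_squarefree hΔ hm
    refine ⟨Algebra.trace ℤ (𝓞 F) x, b, ?_⟩
    apply NumberField.RingOfIntegers.ext
    have h1 := htrace x
    rw [← Algebra.coe_trace_int] at h1
    rw [Rat.cast_intCast] at hx
    change 2 * (x : F) = ((Algebra.trace ℤ (𝓞 F) x : ℤ) : 𝓞 F) + ((b : ℤ) : 𝓞 F) * s
    rw [Rat.cast_intCast] at h1
    have hcast : ∀ m : ℤ, ((m : 𝓞 F) : F) = m := map_intCast (algebraMap (𝓞 F) F)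
    rw [hcast, hcast]
    linear_combination h1 + hx
  · intro x
    apply NumberField.RingOfIntegers.ext
    have h1 := hnorm x
    rw [← Algebra.coe_norm_int] at h1
    simpa using h1

namespace QuadraticConj

variable {Δ : ℤ}

theorem two_mul_σ (C : QuadraticConj F Δ) {x : 𝓞 F} {a b : ℤ} (h : 2 * x = a + b * C.δ) :
    2 * C.σ x = a - b * C.δ := by
  have := congrArg C.σ h
  simpa only [map_mul, map_add, map_ofNat, map_intCast, C.σ_δ, mul_neg, ← sub_eq_add_neg]
    using this

theorem four_mul_norm (C : QuadraticConj F Δ) {x : 𝓞 F} {a b : ℤ} (h : 2 * x = a + b * C.δ) :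
    4 * Algebra.norm ℤ x = a ^ 2 - Δ * b ^ 2 := by
  have h' := C.two_mul_σ h
  have e : ((4 * Algebra.norm ℤ x : ℤ) : 𝓞 F) = ((a ^ 2 - Δ * b ^ 2 : ℤ) : 𝓞 F) := by
    push_cast
    rw [← C.mul_σ, ← C.δ_sq]
    linear_combination (2 * C.σ x) * h + (a + b * C.δ) * h'
  exact_mod_cast e

theorem norm_nonneg (C : QuadraticConj F Δ) (hΔ : Δ < 0) (x : 𝓞 F) : 0 ≤ Algebra.norm ℤ x := by
  obtain ⟨a, b, h⟩ := C.exists_coords x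
  have := C.four_mul_norm h
  nlinarith [sq_nonneg a, sq_nonneg b]

theorem ω_sub_σ_ω (C : QuadraticConj F Δ) : C.ω - C.σ C.ω = C.δ := by
  have h := C.two_mul_ω
  have h' : 2 * C.σ C.ω = 1 - C.δ := by
    simpa using C.two_mul_σ (a := 1) (b := 1) (by simpa using h)
  have : (2 : 𝓞 F) * (C.ω - C.σ C.ω) = 2 * C.δ := by linear_combination h - h'
  exact mul_left_cancel₀ two_ne_zero this

theorem map_map_σ (C : QuadraticConj F Δ) (I : Ideal (𝓞 F)) : (I.map C.σ).map C.σ = I := by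
  have h : (C.σ : 𝓞 F →+* 𝓞 F).comp (C.σ : 𝓞 F →+* 𝓞 F) = RingHom.id _ := RingHom.ext C.σ_σ
  change (I.map (C.σ : 𝓞 F →+* 𝓞 F)).map (C.σ : 𝓞 F →+* 𝓞 F) = I
  rw [Ideal.map_map, h, Ideal.map_id]

theorem span_mul_map_σ (C : QuadraticConj F Δ) (hΔ : Δ < 0) (x : 𝓞 F) :
    Ideal.span {x} * (Ideal.span {x}).map C.σ = Ideal.span 
      {(Ideal.absNorm (Ideal.span {x}) : 𝓞 F)} := by
  rw [Ideal.map_span, Set.image_singleton, Ideal.span_singleton_mul_span_singleton]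
  have h2 : ((Ideal.absNorm (Ideal.span {x}) : ℤ) : 𝓞 F) = (Algebra.norm ℤ x : ℤ) := by
    rw [Ideal.absNorm_span_singleton, Int.natAbs_of_nonneg (C.norm_nonneg hΔ x)]
  rw [← Int.cast_natCast (R := 𝓞 F), h2, ← C.mul_σ]

theorem pow_inj {I J : Ideal (𝓞 F)} {n : ℕ} (hn : n ≠ 0) (h : I ^ n = J ^ n) : I = J :=
  dvd_antisymm ((UniqueFactorizationMonoid.pow_dvd_pow_iff_dvd hn).1 h.dvd)
    ((UniqueFactorizationMonoid.pow_dvd_pow_iff_dvd hn).1 h.symm.dvd)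

/-- For principal ideals this is the norm of a generator, nonnegative because $\Delta<0$. The
general case follows by raising to the class number, since roots of ideals are unique. -/
theorem mul_map_σ (C : QuadraticConj F Δ) (hΔ : Δ < 0) (I : Ideal (𝓞 F)) :
    I * I.map C.σ = Ideal.span {(Ideal.absNorm I : 𝓞 F)} := by
  rcases eq_or_ne I ⊥ with rfl | hI
  · simp
  have hI' := mem_nonZeroDivisors_of_ne_zero hI
  have hh : Fintype.card (ClassGroup (𝓞 F)) ≠ 0 := Fintype.card_ne_zero
  obtain ⟨x, hx⟩ : ∃ x, I ^ Fintype.card (ClassGroup (𝓞 F)) = Ideal.span {x} := by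
    have : ClassGroup.mk0 (⟨I, hI'⟩ ^ Fintype.card (ClassGroup (𝓞 F))) = 1 := by
      rw [map_pow, pow_card_eq_one]
    exact ((ClassGroup.mk0_eq_one_iff (pow_mem hI' _)).1 this).principal
  apply pow_inj hh
  rw [mul_pow, ← Ideal.map_pow, hx, C.span_mul_map_σ hΔ, ← hx, map_pow, Nat.cast_pow,
    Ideal.span_singleton_pow]

theorem absNorm_span_natCast (C : QuadraticConj F Δ) (a : ℕ) : Ideal.absNorm (Ideal.span {(a : 𝓞 F)}) = a ^ 2 := by
  have h : Algebra.norm ℤ (a : 𝓞 F) = (a : ℤ) ^ 2 := by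
    have h1 := C.mul_σ (a : 𝓞 F)
    rw [map_natCast, ← sq] at h1
    exact_mod_cast h1.symm
  rw [Ideal.absNorm_span_singleton, h, Int.natAbs_pow, Int.natAbs_natCast]

/-- The prime $l$ is unramified, so $(l)$ is a squarefree ideal. Concretely, if $l\mid x^2$ then $l$
divides the norm of $x$, then its trace $a$ because $a^2=x^2+\bar x^2+2N(x)$, then $b$ because
$a^2-\Delta b^2=4N(x)$; finally 2 is inverted modulo $l$. -/
theorem le_span_of_sq_le (C : QuadraticConj F Δ) {I : Ideal (𝓞 F)} {l : ℕ} (hl : l.Prime) (hlΔ : IsCoprime (l : ℤ) (2 * Δ))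
    (h : I ^ 2 ≤ Ideal.span {(l : 𝓞 F)}) : I ≤ Ideal.span {(l : 𝓞 F)} := by
  have hlp := Nat.prime_iff_prime_int.1 hl
  intro x hx
  have hxx : x ^ 2 ∈ Ideal.span {(l : 𝓞 F)} := h (Ideal.pow_mem_pow hx 2)
  rw [Ideal.mem_span_singleton] at hxx ⊢
  obtain ⟨y, hy⟩ := hxx
  have σ_coords : ∀ {x : 𝓞 F} {a b : ℤ}, 2 * x = a + b * C.δ → x + C.σ x = a := by
    intro x a b h
    have h' := C.two_mul_σ h
    have : (2 : 𝓞 F) * (x + C.σ x) = 2 * a := by linear_combination h + h'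
    exact mul_left_cancel₀ two_ne_zero this
  obtain ⟨a, b, hab⟩ := C.exists_coords x
  obtain ⟨c, d, hcd⟩ := C.exists_coords y
  have hN : (l : ℤ) ∣ Algebra.norm ℤ x := by
    apply hlp.dvd_of_dvd_pow (n := 2)
    refine ⟨l * Algebra.norm ℤ y, ?_⟩
    have e : ((Algebra.norm ℤ x ^ 2 : ℤ) : 𝓞 F) = ((l * (l * Algebra.norm ℤ y) : ℤ) : 𝓞 F) := by
      have hy' := congrArg C.σ hy
      simp only [map_pow, map_mul, map_natCast] at hy'
      push_cast
      rw [← C.mul_σ, ← C.mul_σ, mul_pow, hy, hy']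
      ring
    exact_mod_cast e
  have ha : (l : ℤ) ∣ a := by
    apply hlp.dvd_of_dvd_pow (n := 2)
    have e : ((a ^ 2 : ℤ) : 𝓞 F) = ((2 * Algebra.norm ℤ x + l * c : ℤ) : 𝓞 F) := by
      have hy' := congrArg C.σ hy
      simp only [map_pow, map_mul, map_natCast] at hy'
      push_cast
      rw [← C.mul_σ, ← σ_coords hab, ← σ_coords hcd]
      linear_combination hy + hy'
    have e' : a ^ 2 = 2 * Algebra.norm ℤ x + l * c := by exact_mod_cast e
    rw [e']
    exact (hN.mul_left 2).add (dvd_mul_right _ _)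
  have hb : (l : ℤ) ∣ b := by
    apply hlp.dvd_of_dvd_pow (n := 2)
    apply (hlΔ.of_mul_right_right).dvd_of_dvd_mul_left
    have := C.four_mul_norm hab
    rw [show Δ * b ^ 2 = a ^ 2 - 4 * Algebra.norm ℤ x by linarith]
    exact (dvd_pow ha two_ne_zero).sub (hN.mul_left 4)
  obtain ⟨u, v, huv⟩ := hlΔ.of_mul_right_left
  obtain ⟨a, rfl⟩ := ha
  obtain ⟨b, rfl⟩ := hb
  refine ⟨u * x + v * (a + b * C.δ), ?_⟩
  have huv' : (u : 𝓞 F) * l + v * 2 = 1 := by exact_mod_cast congrArg (Int.cast : ℤ → 𝓞 F) huv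
  push_cast at hab
  linear_combination (-x) * huv' + v * hab

end QuadraticConj

end Conjugation

/-! ### Symbols attached to principal ideals `𝔡 𝔟²` -/

section Principal

open NumberTheorySymbols

variable {F : Type*} [Field F] [NumberField F]

/-- For $J$ in the class $c^{-1}$ choose $a$ with $J=(a)+mJ$. Then $(a)=JK$, where $K$ lies in $c$
and is prime to $m$. -/
theorem exists_coprime_representative {R : Type*} [CommRing R] [IsDedekindDomain R]
    (c : ClassGroup R) {m : R} (hm : m ≠ 0) :
    ∃ I : nonZeroDivisors (Ideal R), ClassGroup.mk0 I = c ∧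
      IsCoprime (I : Ideal R) (Ideal.span {m}) := by
  obtain ⟨J, hJ⟩ := ClassGroup.mk0_surjective c⁻¹
  have hJ0 : (J : Ideal R) ≠ 0 := nonZeroDivisors.coe_ne_zero J
  have hm0 : Ideal.span {m} ≠ 0 := by simpa using hm
  have hle : (J : Ideal R) * Ideal.span {m} ≤ J := Ideal.mul_le_left
  obtain ⟨a, ha⟩ := IsDedekindDomain.exists_sup_span_eq hle (mul_ne_zero hJ0 hm0)
  obtain ⟨K, hK⟩ : (J : Ideal R) ∣ Ideal.span {a} :=
    Ideal.dvd_iff_le.2 (le_sup_right.trans ha.le)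
  rw [hK, ← Ideal.add_eq_sup, ← mul_add] at ha
  have h1 : Ideal.span {m} + K = 1 := mul_left_cancel₀ hJ0 (ha.trans (mul_one _).symm)
  have hcop : IsCoprime K (Ideal.span {m}) := by
    rw [Ideal.isCoprime_iff_add, add_comm, h1]
  -- $K=0$ forces $m$ to be a unit, and then any representative will do.
  rcases eq_or_ne K 0 with hK0 | hK0
  · obtain ⟨I, hI⟩ := ClassGroup.mk0_surjective c
    refine ⟨I, hI, ?_⟩
    rw [hK0, add_zero] at h1
    rw [h1]
    exact isCoprime_one_right
  refine ⟨⟨K, mem_nonZeroDivisors_of_ne_zero hK0⟩, ?_, hcop⟩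
  rw [← inv_inv c, ← hJ, ClassGroup.mk0_eq_mk0_inv_iff]
  refine ⟨a, ?_, (mul_comm _ _).trans hK.symm⟩
  rintro rfl
  rw [Ideal.span_singleton_zero] at hK
  exact mul_ne_zero hJ0 hK0 hK.symm

theorem Ideal.isPrincipal_of_span_mul {R : Type*} [CommRing R] [IsDedekindDomain R] {k : R}
    (hk : k ≠ 0) {I : Ideal R} (h : (Ideal.span {k} * I).IsPrincipal) : I.IsPrincipal := by
  obtain ⟨a, ha⟩ := h.principal
  have ha' : a ∈ Ideal.span {k} :=
    Ideal.mul_le_left (ha.symm.le (Ideal.mem_span_singleton_self a))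
  obtain ⟨b, rfl⟩ := Ideal.mem_span_singleton.1 ha'
  refine ⟨b, mul_left_cancel₀ (a := Ideal.span {k}) (by simpa using hk) (ha.trans ?_)⟩
  exact (Ideal.span_singleton_mul_span_singleton k b).symm

namespace QuadraticConj

variable {Δ : ℤ}

/-- Since $m$ is rational, the conjugate of $I$ is also prime to $m$, hence so is $I\bar I=(NI)$.
Coprimality descends to $\mathbb Z$ because a rational integer that is a unit in $\mathcal O_F$ is
$\pm1$. -/
theorem isCoprime_absNorm (C : QuadraticConj F Δ) (hΔ : Δ < 0) {I : Ideal (𝓞 F)} {m : ℤ}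
    (h : IsCoprime I (Ideal.span {(m : 𝓞 F)})) : IsCoprime (Ideal.absNorm I : ℤ) m := by
  have h' : IsCoprime (I.map C.σ) (Ideal.span {(m : 𝓞 F)}) := by
    have := h.map (Ideal.mapHom (C.σ : 𝓞 F →+* 𝓞 F))
    simp only [Ideal.mapHom_apply, Ideal.map_span, Set.image_singleton, map_intCast] at this
    exact this
  have h2 := h.mul_left h'
  rw [C.mul_map_σ hΔ, Ideal.isCoprime_span_singleton_iff] at h2
  rw [Int.isCoprime_iff_gcd_eq_one]
  set g := (Ideal.absNorm I : ℤ).gcd m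
  have hd : ((g : ℤ) : 𝓞 F) ∣ 1 := by
    obtain ⟨u, v, huv⟩ := h2
    rw [← huv]
    refine dvd_add (Dvd.dvd.mul_left ?_ _) (Dvd.dvd.mul_left ?_ _)
    · rw [← Int.cast_natCast (Ideal.absNorm I)]
      exact Int.cast_dvd_cast _ _ (Int.gcd_dvd_left _ _)
    · exact Int.cast_dvd_cast _ _ (Int.gcd_dvd_right _ _)
  have h3 : Ideal.span {(g : 𝓞 F)} = ⊤ := by
    rw [Ideal.span_singleton_eq_top]
    exact isUnit_of_dvd_one (by simpa using hd)
  have h4 := C.absNorm_span_natCast g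
  rw [h3, Ideal.absNorm_top] at h4
  exact (Nat.pow_eq_one.1 h4.symm).resolve_right two_ne_zero

theorem absNorm_eq_of_sq (C : QuadraticConj F Δ) {I : Ideal (𝓞 F)} {d : ℕ}
    (h : I ^ 2 = Ideal.span {(d : 𝓞 F)}) : Ideal.absNorm I = d := by
  have h1 := C.absNorm_span_natCast d
  rw [← h, map_pow] at h1
  exact Nat.pow_left_injective (n := 2) two_ne_zero h1

/-- The norm of $\alpha$ is $D(NJ)^2$, so $D$ divides the square of the first coordinate of
$2\alpha$, and the coordinate itself as $D$ is squarefree. Dividing the norm equation by $D$ gives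
the conic. -/
theorem exists_norm_eq (C : QuadraticConj F Δ) (hΔ : Δ < 0) {D : ℕ} {a : ℤ} (hDa : Δ = D * a)
    (hD : Squarefree D) {I J : Ideal (𝓞 F)} (hI : I ^ 2 = Ideal.span {(D : 𝓞 F)}) {α : 𝓞 F}
    (hα : I * J ^ 2 = Ideal.span {α}) :
    ∃ x y : ℤ, 2 * α = (D * x : ℤ) + y * C.δ ∧
      D * x ^ 2 - a * y ^ 2 = 4 * (Ideal.absNorm J : ℤ) ^ 2 := by
  obtain ⟨x, y, h⟩ := C.exists_coords α
  have h4 := C.four_mul_norm h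
  have hN : Algebra.norm ℤ α = D * (Ideal.absNorm J : ℤ) ^ 2 := by
    rw [← Int.natAbs_of_nonneg (C.norm_nonneg hΔ α), ← Ideal.absNorm_span_singleton, ← hα,
      map_mul, map_pow, C.absNorm_eq_of_sq hI]
    push_cast; rfl
  rw [hN, hDa] at h4
  have hx : (D : ℤ) ∣ x := by
    refine ((Int.squarefree_natCast.2 hD).dvd_pow_iff_dvd two_ne_zero).1
      ⟨4 * (Ideal.absNorm J : ℤ) ^ 2 + a * y ^ 2, by linarith⟩
  obtain ⟨x, rfl⟩ := hx
  refine ⟨x, y, h, ?_⟩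
  have hD0 : (D : ℤ) ≠ 0 := by exact_mod_cast hD.ne_zero
  apply mul_left_cancel₀ hD0
  linarith

theorem isQuadraticResidue_of_isPrincipal (C : QuadraticConj F Δ) (hΔ : Δ < 0) {D : ℕ} {a : ℤ}
    (hDa : Δ = D * a) (hD : Squarefree D) {I J : Ideal (𝓞 F)}
    (hI : I ^ 2 = Ideal.span {(D : 𝓞 F)}) (hJ : IsCoprime J (Ideal.span {((2 * Δ : ℤ) : 𝓞 F)}))
    (h : (I * J ^ 2).IsPrincipal) {q : ℕ} (hq : q ∈ D.primeFactors) (hq4 : q % 4 = 1) :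
    IsQuadraticResidue a q := by
  obtain ⟨α, hα⟩ := h.principal
  obtain ⟨x, y, -, he⟩ := C.exists_norm_eq hΔ hDa hD hI hα
  have hc := C.isCoprime_absNorm hΔ hJ
  set z := (Ideal.absNorm J : ℤ)
  have hqp := Nat.prime_of_mem_primeFactors hq
  have := Fact.mk hqp
  have hqD : (q : ℤ) ∣ D := Int.natCast_dvd_natCast.2 (Nat.dvd_of_mem_primeFactors hq)
  have hz : ((2 * z : ℤ) : ZMod q) ≠ 0 := fun h0 => by
    rw [ZMod.intCast_zmod_eq_zero_iff_dvd] at h0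
    rcases (Nat.prime_iff_prime_int.1 hqp).dvd_mul.1 h0 with h0 | h0
    · have := Nat.le_of_dvd two_pos (Int.natCast_dvd_natCast.1 h0)
      have := hqp.two_le
      omega
    · exact (Nat.prime_iff_prime_int.1 hqp).not_isUnit
        (hc.isUnit_of_dvd' h0 (hqD.trans ⟨2 * a, by rw [hDa]; ring⟩))
  have hDq : (D : ZMod q) = 0 := by
    exact_mod_cast (ZMod.intCast_zmod_eq_zero_iff_dvd D q).2 hqD
  have hmod : (a : ZMod q) * (y : ZMod q) ^ 2 = -((2 * z : ℤ) : ZMod q) ^ 2 := by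
    have := congrArg (Int.cast : ℤ → ZMod q) he
    push_cast at this ⊢
    rw [hDq] at this
    linear_combination -this
  have hne : (a : ZMod q) * (y : ZMod q) ^ 2 ≠ 0 := by
    rw [hmod]
    exact neg_ne_zero.2 (pow_ne_zero 2 hz)
  have hy : (y : ZMod q) ≠ 0 := fun h0 => hne (by rw [h0]; ring)
  obtain ⟨i, hi⟩ := ZMod.exists_sq_eq_neg_one_iff.2 (show q % 4 ≠ 3 by omega)
  refine ⟨left_ne_zero_of_mul hne, i * (2 * z : ℤ) / y, ?_⟩
  field_simp
  linear_combination hmod + (((2 * z : ℤ) : ZMod q) ^ 2) * hi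

/-- Induction on $NJ$. If $y$ and $z=NJ$ are coprime, `quarticSymbolProd_eq_jacobiSym` applies.
Otherwise a common prime $l$ also divides $x$, hence $\alpha$, so $J=(l)K$. Passing to $K$ divides
the norm by $l^2$, which leaves the Jacobi symbol unchanged. -/
theorem quarticSymbolProd_of_isPrincipal (C : QuadraticConj F Δ) (hΔ : Δ < 0) {D : ℕ} {a : ℤ}
    (hDa : Δ = D * a) (hD : Squarefree D) (hD4 : ∀ q ∈ D.primeFactors, q % 4 = 1)
    (ha : a % 4 = 1) {I J : Ideal (𝓞 F)} (hI : I ^ 2 = Ideal.span {(D : 𝓞 F)})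
    (hJ : IsCoprime J (Ideal.span {((2 * Δ : ℤ) : 𝓞 F)})) (h : (I * J ^ 2).IsPrincipal) :
    (quarticSymbolProd a D : ℤ) = J((Ideal.absNorm J : ℤ) | D) := by
  induction hN : Ideal.absNorm J using Nat.strong_induction_on generalizing J with
  | _ z ih =>
  obtain ⟨α, hα⟩ := h.principal
  obtain ⟨x, y, hxy, he⟩ := C.exists_norm_eq hΔ hDa hD hI hα
  have hc := C.isCoprime_absNorm hΔ hJ
  rw [hN] at he hc
  have hcD : IsCoprime (z : ℤ) D := hc.of_isCoprime_of_dvd_right ⟨2 * a, by rw [hDa]; ring⟩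
  have hc2 : IsCoprime (z : ℤ) 2 := hc.of_mul_right_left
  have hzodd : (z : ℤ) % 2 = 1 := by
    obtain ⟨u, v, huv⟩ := hc2
    rcases Int.emod_two_eq_zero_or_one z with h0 | h0
    · obtain ⟨w, hw⟩ := Int.dvd_of_emod_eq_zero h0
      rw [hw] at huv
      have : 2 * (u * w + v) = 1 := by linarith
      omega
    · exact h0
  have hz0 : z ≠ 0 := by rintro rfl; simp at hzodd
  rcases eq_or_ne D 1 with rfl | hD1
  · simp [quarticSymbolProd]
  -- With $y=0$, a prime $q\mid D$ would divide $(2z)^2$, though $q$ is odd and prime to $z$.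
  have hy0 : y ≠ 0 := by
    rintro rfl
    obtain ⟨q, hq, hqD⟩ := Nat.exists_prime_and_dvd hD1
    have hq4 := hD4 q (Nat.mem_primeFactors.2 ⟨hq, hqD, hD.ne_zero⟩)
    have hqp := Nat.prime_iff_prime_int.1 hq
    have hqD' : (q : ℤ) ∣ D := Int.natCast_dvd_natCast.2 hqD
    have h0 : (q : ℤ) ∣ (2 * z) ^ 2 :=
      hqD'.trans ⟨x ^ 2, by linarith⟩
    rcases hqp.dvd_mul.1 (hqp.dvd_of_dvd_pow h0) with h0 | h0
    · have := Nat.le_of_dvd two_pos (Int.natCast_dvd_natCast.1 h0)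
      have := hq.two_le
      omega
    · exact hqp.not_isUnit (hcD.isUnit_of_dvd' h0 hqD')
  by_cases hyz : IsCoprime y (z : ℤ)
  · refine quarticSymbolProd_eq_jacobiSym (y := y.natAbs) (x := x) hD hD4 ha ?_ hzodd hcD
      (Int.natAbs_ne_zero.2 hy0) ?_
    · rw [Int.natCast_natAbs, sq_abs]; exact he
    · rw [Int.natCast_natAbs]; exact hyz.abs_left
  obtain ⟨l, hl, hly, hlz⟩ : ∃ l : ℕ, l.Prime ∧ (l : ℤ) ∣ y ∧ (l : ℤ) ∣ z := by
    rw [Int.isCoprime_iff_gcd_eq_one] at hyz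
    obtain ⟨l, hl, hd⟩ := Nat.exists_prime_and_dvd hyz
    have := Int.natCast_dvd_natCast.2 hd
    exact ⟨l, hl, this.trans (Int.gcd_dvd_left _ _), this.trans (Int.gcd_dvd_right _ _)⟩
  have hlΔ : IsCoprime (l : ℤ) (2 * Δ) := hc.of_isCoprime_of_dvd_left hlz
  have hlD : IsCoprime (l : ℤ) D := hcD.of_isCoprime_of_dvd_left hlz
  have hlp := Nat.prime_iff_prime_int.1 hl
  have hlx : (l : ℤ) ∣ x := by
    refine hlp.dvd_of_dvd_pow (n := 2) (hlD.dvd_of_dvd_mul_left ?_)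
    rw [show (D : ℤ) * x ^ 2 = 4 * (z : ℤ) ^ 2 + a * y ^ 2 by linarith]
    exact ((dvd_pow hlz two_ne_zero).mul_left _).add ((dvd_pow hly two_ne_zero).mul_left _)
  obtain ⟨x, rfl⟩ := hlx
  obtain ⟨y, rfl⟩ := hly
  have hαl : α ∈ Ideal.span {(l : 𝓞 F)} := by
    rw [Ideal.mem_span_singleton]
    obtain ⟨u, v, huv⟩ := hlΔ.of_mul_right_left
    have huv' : (u : 𝓞 F) * l + v * 2 = 1 := by exact_mod_cast congrArg (Int.cast : ℤ → 𝓞 F) huv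
    refine ⟨u * α + v * (D * x + y * C.δ), ?_⟩
    push_cast at hxy
    linear_combination (-α) * huv' + v * hxy
  have hle : I * J ^ 2 ≤ Ideal.span {(l : 𝓞 F)} := by
    rw [hα]
    exact (Ideal.span_singleton_le_iff_mem _).2 hαl
  -- Multiplying by $I$ gives $DJ^2=I\cdot IJ^2\subseteq(l)$, and $D$ is invertible modulo $l$.
  have hJ2 : J ^ 2 ≤ Ideal.span {(l : 𝓞 F)} := by
    intro b hb
    have h1 : (D : 𝓞 F) * b ∈ Ideal.span {(l : 𝓞 F)} := by
      have h2 : (D : 𝓞 F) * b ∈ I * (I * J ^ 2) := by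
        rw [← mul_assoc, ← sq, hI]
        exact Ideal.mul_mem_mul (Ideal.mem_span_singleton_self _) hb
      exact hle (Ideal.mul_le_right h2)
    obtain ⟨u, v, huv⟩ := hlD
    have huv' : (u : 𝓞 F) * l + v * D = 1 := by exact_mod_cast congrArg (Int.cast : ℤ → 𝓞 F) huv
    rw [show b = u * b * l + v * (D * b) by linear_combination (-b) * huv']
    exact Ideal.add_mem _ (Ideal.mul_mem_left _ _ (Ideal.mem_span_singleton_self _))
      (Ideal.mul_mem_left _ _ h1)
  obtain ⟨K, rfl⟩ := Ideal.dvd_iff_le.2 (C.le_span_of_sq_le hl hlΔ hJ2)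
  have hNK : l ^ 2 * Ideal.absNorm K = z := by
    rw [← hN, map_mul, C.absNorm_span_natCast]
  have hl0 : (l : 𝓞 F) ≠ 0 := by exact_mod_cast hl.ne_zero
  have hKp : (I * K ^ 2).IsPrincipal := by
    apply Ideal.isPrincipal_of_span_mul (pow_ne_zero 2 hl0)
    rw [← Ideal.span_singleton_pow]
    rwa [mul_pow, mul_left_comm] at h
  have hK0 : 0 < Ideal.absNorm K := Nat.pos_of_ne_zero fun h0 => hz0 (by rw [← hNK, h0, mul_zero])
  rw [ih _ (hNK ▸ lt_mul_of_one_lt_left hK0 (Nat.one_lt_pow two_ne_zero hl.one_lt))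
    hJ.of_mul_left_right hKp rfl, ← hNK]
  push_cast
  rw [jacobiSym.mul_left, jacobiSym.sq_one' (Int.isCoprime_iff_gcd_eq_one.1 hlD), one_mul]

end QuadraticConj

end Principal

/-! ### Ambiguous ideal classes -/

section Ambiguous

variable {F : Type*} [Field F] [NumberField F]

theorem ClassGroup.mk0_eq_one_iff_isPrincipal {R : Type*} [CommRing R] [IsDedekindDomain R]
    {I : nonZeroDivisors (Ideal R)} : ClassGroup.mk0 I = 1 ↔ (I : Ideal R).IsPrincipal :=
  ClassGroup.mk0_eq_one_iff I.2

namespace QuadraticConj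

variable {Δ : ℤ}

theorem dvd_of_intCast_mem_span (C : QuadraticConj F Δ) {l : ℕ} {m : ℤ}
    (h : (m : 𝓞 F) ∈ Ideal.span {(l : 𝓞 F)}) : (l : ℤ) ∣ m := by
  have h1 : Ideal.absNorm (Ideal.span {(l : 𝓞 F)}) ∣ Ideal.absNorm (Ideal.span {(m : 𝓞 F)}) :=
    map_dvd _ (Ideal.dvd_iff_le.2 ((Ideal.span_singleton_le_iff_mem _).2 h))
  have h2 : Ideal.span {(m : 𝓞 F)} = Ideal.span {((m.natAbs : ℕ) : 𝓞 F)} := by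
    rcases Int.natAbs_eq m with hm | hm
    · conv_lhs => rw [hm]
      rw [Int.cast_natCast]
    · conv_lhs => rw [hm]
      rw [Int.cast_neg, Int.cast_natCast, Ideal.span_singleton_neg]
  rw [h2, C.absNorm_span_natCast, C.absNorm_span_natCast, Nat.pow_dvd_pow_iff two_ne_zero] at h1
  exact Int.natCast_dvd.2 h1

/-- The ideal $P=(q,\sqrt\Delta)$ has $P^2=(q^2,q\sqrt\Delta,\Delta)=(q)$, since $q$ divides
$\Delta$ exactly once. Its norm is $q$, so it is prime and equals the radical of $(q)$. -/
theorem primeAbove_sq (C : QuadraticConj F Δ) (hΔ : Squarefree Δ) {q : ℕ} (hq : q.Prime)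
    (hqΔ : (q : ℤ) ∣ Δ) : primeAbove F q ^ 2 = Ideal.span {(q : 𝓞 F)} := by
  obtain ⟨k, hk⟩ := hqΔ
  have hqp := Nat.prime_iff_prime_int.1 hq
  have hcop : IsCoprime (q : ℤ) k := by
    rw [hqp.coprime_iff_not_dvd]
    rintro ⟨j, rfl⟩
    exact hqp.not_isUnit (hΔ _ ⟨j, by rw [hk]; ring⟩)
  have hδ : C.δ * C.δ = q * k := by rw [← sq, C.δ_sq, hk]; push_cast; rfl
  set P : Ideal (𝓞 F) := Ideal.span {(q : 𝓞 F), C.δ}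
  have hP : P ^ 2 = Ideal.span {(q : 𝓞 F)} := by
    rw [sq, Ideal.span_pair_mul_span_pair]
    apply le_antisymm
    · rw [Ideal.span_le]
      rintro x (rfl | rfl | rfl | rfl)
      · exact Ideal.mul_mem_left _ _ (Ideal.mem_span_singleton_self _)
      · exact Ideal.mul_mem_right _ _ (Ideal.mem_span_singleton_self _)
      · exact Ideal.mul_mem_left _ _ (Ideal.mem_span_singleton_self _)
      · rw [hδ]
        exact Ideal.mul_mem_right _ _ (Ideal.mem_span_singleton_self _)
    · rw [Ideal.span_singleton_le_iff_mem]
      obtain ⟨u, v, huv⟩ := hcop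
      have huv' : (u : 𝓞 F) * q + v * k = 1 := by
        exact_mod_cast congrArg (Int.cast : ℤ → 𝓞 F) huv
      have e : (u : 𝓞 F) * (q * q) + v * (C.δ * C.δ) = q := by
        rw [hδ]; linear_combination (q : 𝓞 F) * huv'
      have hmem : (u : 𝓞 F) * (q * q) + v * (C.δ * C.δ) ∈
          Ideal.span {(q : 𝓞 F) * q, q * C.δ, C.δ * q, C.δ * C.δ} :=
        Ideal.add_mem _ (Ideal.mul_mem_left _ _ (Ideal.subset_span (by simp)))
          (Ideal.mul_mem_left _ _ (Ideal.subset_span (by simp)))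
      rwa [e] at hmem
  have hprime : P.IsPrime := Ideal.isPrime_of_irreducible_absNorm (by
    rw [C.absNorm_eq_of_sq hP]; exact hq)
  rw [primeAbove, ← hP, Ideal.radical_pow _ two_ne_zero, hprime.radical]

/-- The residue field is $\mathbb F_l$, so conjugation acts trivially on it and
$\omega-\bar\omega=\sqrt\Delta$ vanishes there. Using $\omega$ rather than $\sqrt\Delta$ makes the
argument valid for $l=2$. -/
theorem δ_mem_of_map_eq (C : QuadraticConj F Δ) {Q : Ideal (𝓞 F)} {l : ℕ} (hl : l.Prime)
    (hQ : Ideal.absNorm Q = l) (h : Q.map C.σ = Q) : C.δ ∈ Q := by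
  have hcard : Nat.card (𝓞 F ⧸ Q) = l := hQ
  have : Finite (𝓞 F ⧸ Q) := Nat.finite_of_card_ne_zero (hcard ▸ hl.ne_zero)
  have := Fintype.ofFinite (𝓞 F ⧸ Q)
  rw [Nat.card_eq_fintype_card] at hcard
  have : NeZero l := ⟨hl.ne_zero⟩
  let e := ZMod.ringEquivOfPrime (𝓞 F ⧸ Q) hl hcard
  obtain ⟨k, hk⟩ : ∃ k : ℕ, C.ω - k ∈ Q := by
    obtain ⟨y, hy⟩ := e.surjective (Ideal.Quotient.mk Q C.ω)
    refine ⟨y.val, ?_⟩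
    rw [← Ideal.Quotient.eq_zero_iff_mem, map_sub, ← hy, map_natCast, ← map_natCast e,
      ZMod.natCast_zmod_val, sub_self]
  have hk' : C.σ C.ω - k ∈ Q := by
    have := Ideal.mem_map_of_mem C.σ hk
    rwa [h, map_sub, map_natCast] at this
  rw [← C.ω_sub_σ_ω]
  simpa using Q.sub_mem hk hk'

/-- Take a prime $Q\mid I$. If $\bar Q\ne Q$, then $Q\bar Q$ divides $I$ and is principal. If $\bar
Q=Q$, then for a prime $l\mid NQ$ the ideal $(l)$ is $Q$ (inert) or $Q^2$ (ramified). -/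
theorem exists_invariant_dvd (C : QuadraticConj F Δ) (hΔ0 : Δ < 0) (hΔ : Squarefree Δ)
    {I : Ideal (𝓞 F)} (hI0 : I ≠ ⊥) (hI : I ≠ ⊤) (h : I.map C.σ = I) :
    ∃ P : Ideal (𝓞 F), P ∣ I ∧ P ≠ ⊤ ∧ P.map C.σ = P ∧
      (P.IsPrincipal ∨ ∃ q : ℕ, q.Prime ∧ (q : ℤ) ∣ Δ ∧ P = primeAbove F q) := by
  obtain ⟨Q, hQm, hIQ⟩ := Ideal.exists_le_maximal I hI
  have hQ0 : Q ≠ ⊥ := ne_bot_of_le_ne_bot hI0 hIQ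
  have hQp : Prime Q := Ideal.prime_of_isPrime hQ0 hQm.isPrime
  have hdvd : Q ∣ I := Ideal.dvd_iff_le.2 hIQ
  have hmul := C.mul_map_σ hΔ0 Q
  by_cases hσ : Q.map C.σ = Q
  · rw [hσ, ← sq] at hmul
    set N := Ideal.absNorm Q with hN
    have hN1 : N ≠ 1 := fun h1 => hQm.ne_top (Ideal.absNorm_eq_one_iff.1 h1)
    obtain ⟨l, hl, k, hk⟩ := Nat.exists_prime_and_dvd hN1
    have hd : Ideal.span {(l : 𝓞 F)} ∣ Q ^ 2 := by
      refine ⟨Ideal.span {(k : 𝓞 F)}, ?_⟩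
      rw [hmul, Ideal.span_singleton_mul_span_singleton, hk, Nat.cast_mul]
    obtain ⟨i, hi, hass⟩ := (dvd_prime_pow hQp 2).1 hd
    rw [associated_iff_eq] at hass
    refine ⟨Q, hdvd, hQm.ne_top, hσ, ?_⟩
    have hNl := C.absNorm_span_natCast l
    rw [hass, map_pow, ← hN] at hNl
    interval_cases i
    · exact absurd hNl.symm (by simpa using hl.ne_one)
    · exact Or.inl ⟨l, by rw [← pow_one Q, ← hass]⟩
    · have hNl' : N = l := Nat.pow_left_injective (n := 2) two_ne_zero hNl
      have hlΔ : (l : ℤ) ∣ Δ := by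
        apply C.dvd_of_intCast_mem_span
        rw [hass, ← C.δ_sq]
        exact Ideal.pow_mem_pow (C.δ_mem_of_map_eq hl hNl' hσ) 2
      refine Or.inr ⟨l, hl, hlΔ, pow_inj two_ne_zero ?_⟩
      rw [C.primeAbove_sq hΔ hl hlΔ, hass]
  · obtain ⟨K, rfl⟩ := hdvd
    have hd : Q.map C.σ ∣ Q * K := by
      rw [← h, Ideal.map_mul]
      exact dvd_mul_right _ _
    have hmax : (Q.map C.σ).IsMaximal := Ideal.map_isMaximal_of_equiv C.σ
    have hσ0 : Q.map C.σ ≠ ⊥ := fun h0 => hQ0 ((Ideal.map_eq_bot_iff_of_injective C.σ.injective).1 h0)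
    rcases (Ideal.prime_of_isPrime hσ0 hmax.isPrime).dvd_or_dvd hd with h1 | h1
    · exact absurd (hQm.eq_of_le hmax.ne_top (Ideal.dvd_iff_le.1 h1)).symm hσ
    · refine ⟨Q * Q.map C.σ, mul_dvd_mul_left Q h1, ?_, ?_, Or.inl ⟨_, hmul⟩⟩
      · exact fun h2 => hQm.ne_top (top_le_iff.1 (h2 ▸ Ideal.mul_le_left))
      · rw [Ideal.map_mul, C.map_map_σ, mul_comm]

theorem mk0_mem_of_map_eq (C : QuadraticConj F Δ) (hΔ0 : Δ < 0) (hΔ : Squarefree Δ)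
    (H : Subgroup (ClassGroup (𝓞 F)))
    (hH : ∀ q : ℕ, q.Prime → (q : ℤ) ∣ Δ → primeClass F q ∈ H)
    (I : nonZeroDivisors (Ideal (𝓞 F))) (h : (I : Ideal (𝓞 F)).map C.σ = I) :
    ClassGroup.mk0 I ∈ H := by
  induction hN : Ideal.absNorm (I : Ideal (𝓞 F)) using Nat.strong_induction_on
    generalizing I with
  | _ N ih =>
  have hI0 : (I : Ideal (𝓞 F)) ≠ ⊥ := nonZeroDivisors.coe_ne_zero I
  by_cases hI : (I : Ideal (𝓞 F)) = ⊤
  · rw [show I = 1 from Subtype.ext (hI.trans Ideal.one_eq_top.symm), map_one]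
    exact H.one_mem
  obtain ⟨P, ⟨K, hK⟩, hP1, hPσ, hP⟩ := C.exists_invariant_dvd hΔ0 hΔ hI0 hI h
  have hP0 : P ≠ 0 := by rintro rfl; exact hI0 (by rw [hK, zero_mul]; rfl)
  have hK0 : K ≠ 0 := by rintro rfl; exact hI0 (by rw [hK, mul_zero]; rfl)
  have hKσ : K.map C.σ = K := by
    rw [hK, Ideal.map_mul, hPσ] at h
    exact mul_left_cancel₀ hP0 h
  have hlt : Ideal.absNorm K < N := by
    rw [← hN, hK, map_mul]
    refine lt_mul_of_one_lt_left (Nat.pos_of_ne_zero (mt Ideal.absNorm_eq_zero_iff.1 hK0)) ?_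
    have h1 := mt Ideal.absNorm_eq_one_iff.1 hP1
    have h2 : Ideal.absNorm P ≠ 0 := mt Ideal.absNorm_eq_zero_iff.1 hP0
    omega
  have hP0' := mem_nonZeroDivisors_of_ne_zero hP0
  have hK0' := mem_nonZeroDivisors_of_ne_zero hK0
  have e : I = ⟨P, hP0'⟩ * ⟨K, hK0'⟩ := Subtype.ext hK
  rw [e, map_mul]
  refine H.mul_mem ?_ (ih _ hlt ⟨K, hK0'⟩ hKσ rfl)
  rcases hP with hP | ⟨q, hq, hqΔ, rfl⟩
  · rw [(ClassGroup.mk0_eq_one_iff hP0').2 hP]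
    exact H.one_mem
  · have := hH q hq hqΔ
    rwa [primeClass, dif_pos hq.ne_zero] at this

/-- An explicit Hilbert 90. If $A^2=(\alpha)$ and $m=NA$, then $\alpha/m$ has norm 1, the norm of
$\alpha$ being $+m^2$ as $\Delta<0$. The element $\gamma=\alpha+m$ satisfies
$m\gamma=\alpha\bar\gamma$, so in $(\gamma)=AB$ the ideal $B$ is invariant and lies in the inverse
class of $A$. -/
theorem mem_of_sq_eq_one (C : QuadraticConj F Δ) (hΔ0 : Δ < 0) (hΔ : Squarefree Δ)
    (H : Subgroup (ClassGroup (𝓞 F)))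
    (hH : ∀ q : ℕ, q.Prime → (q : ℤ) ∣ Δ → primeClass F q ∈ H)
    {c : ClassGroup (𝓞 F)} (hc : c ^ 2 = 1) : c ∈ H := by
  obtain ⟨A, rfl⟩ := ClassGroup.mk0_surjective c
  have hA0 : (A : Ideal (𝓞 F)) ≠ 0 := nonZeroDivisors.coe_ne_zero A
  have hσA0 : (A : Ideal (𝓞 F)).map C.σ ≠ 0 := fun h0 =>
    hA0 ((Ideal.map_eq_bot_iff_of_injective C.σ.injective).1 h0)
  rw [← map_pow, ClassGroup.mk0_eq_one_iff_isPrincipal, SubmonoidClass.coe_pow] at hc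
  obtain ⟨α, hα⟩ : ∃ α, (A : Ideal (𝓞 F)) ^ 2 = Ideal.span {α} := hc.principal
  set m := Ideal.absNorm (A : Ideal (𝓞 F)) with hm
  have hAA : (A : Ideal (𝓞 F)) * (A : Ideal (𝓞 F)).map C.σ = Ideal.span {(m : 𝓞 F)} :=
    C.mul_map_σ hΔ0 A
  have hαα : α * C.σ α = (m : 𝓞 F) ^ 2 := by
    have h1 : Algebra.norm ℤ α = (m : ℤ) ^ 2 := by
      rw [← Int.natAbs_of_nonneg (C.norm_nonneg hΔ0 α), ← Ideal.absNorm_span_singleton, ← hα,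
        map_pow, ← hm]
      push_cast; rfl
    rw [C.mul_σ, h1]
    push_cast; rfl
  -- If $\alpha=-m$, then $A^2=(m)=A\bar A$ and $A$ is itself invariant.
  by_cases hγ : α + m = 0
  · refine C.mk0_mem_of_map_eq hΔ0 hΔ H hH A (mul_left_cancel₀ hA0 ?_)
    rw [hAA, ← sq, hα, eq_neg_of_add_eq_zero_left hγ, Ideal.span_singleton_neg]
  have hmem : α + m ∈ (A : Ideal (𝓞 F)) :=
    Ideal.add_mem _ (Ideal.pow_le_self two_ne_zero (hα ▸ Ideal.mem_span_singleton_self α))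
      (Ideal.absNorm_mem _)
  obtain ⟨B, hB⟩ := Ideal.dvd_iff_le.2 ((Ideal.span_singleton_le_iff_mem _).2 hmem)
  have hB0 : B ≠ 0 := by
    rintro rfl
    rw [mul_zero] at hB
    exact hγ (Ideal.span_singleton_eq_bot.1 hB)
  have hBσ : B.map C.σ = B := by
    have h1 : Ideal.span {(m : 𝓞 F)} * Ideal.span {α + m} =
        Ideal.span {α} * (Ideal.span {α + m}).map C.σ := by
      rw [Ideal.map_span, Set.image_singleton, Ideal.span_singleton_mul_span_singleton,
        Ideal.span_singleton_mul_span_singleton, map_add, map_natCast]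
      congr 2
      linear_combination -hαα
    rw [hB, Ideal.map_mul, ← hα, ← hAA] at h1
    apply mul_left_cancel₀ (mul_ne_zero (mul_ne_zero hA0 hA0) hσA0)
    rw [mul_assoc, ← sq, ← h1]
    ring
  have hB0' := mem_nonZeroDivisors_of_ne_zero hB0
  have e : ClassGroup.mk0 A = (ClassGroup.mk0 ⟨B, hB0'⟩)⁻¹ :=
    ClassGroup.mk0_eq_mk0_inv_iff.2 ⟨α + m, hγ, hB.symm⟩
  rw [e]
  exact H.inv_mem (C.mk0_mem_of_map_eq hΔ0 hΔ H hH ⟨B, hB0'⟩ hBσ)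

end QuadraticConj

end Ambiguous

/-! ### The `8`-rank -/

section TwoPowRank

theorem natCard_eq_two_pow_finrank (V : Type*) [AddCommGroup V] [Module (ZMod 2) V] [Finite V] :
    Nat.card V = 2 ^ Module.finrank (ZMod 2) V := by
  rw [Module.natCard_eq_pow_finrank (K := ZMod 2), Nat.card_zmod]

/-- Squaring on the finite group of $2^k$-th powers has kernel and cokernel of equal order. -/
theorem two_pow_twoPowRank (G : Type*) [CommGroup G] [Finite G] (k : ℕ) :
    2 ^ twoPowRank G (k + 1) = Nat.card {c : G // c ^ 2 = 1 ∧ c ∈ powSubgroup G (2 ^ k)} := by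
  set H := powSubgroup G (2 ^ k)
  let f : H →* H := powMonoidHom 2
  have hrange : (powSubgroup G (2 ^ (k + 1))).subgroupOf H = f.range := by
    ext ⟨x, hx⟩
    rw [Subgroup.mem_subgroupOf]
    constructor
    · rintro ⟨g, rfl⟩
      exact ⟨⟨g ^ 2 ^ k, g, rfl⟩, Subtype.ext (by simp [f, pow_succ, pow_mul])⟩
    · rintro ⟨⟨_, g, rfl⟩, hy⟩
      exact ⟨g, by simpa [f, pow_succ, pow_mul] using congrArg Subtype.val hy⟩
  have hfin : Finite (TwoPowQuotient G (k + 1)) := Quotient.finite _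
  have h1 : Nat.card (TwoPowQuotient G (k + 1)) = 2 ^ twoPowRank G (k + 1) := by
    rw [twoPowRank, natCard_eq_two_pow_finrank]
  have h2 : Nat.card (TwoPowQuotient G (k + 1)) = f.range.index := by
    rw [← hrange]; rfl
  have h3 : f.range.index = Nat.card f.ker := by
    have e1 := f.ker.card_mul_index
    have e2 := f.range.card_mul_index
    rw [Subgroup.index_ker, ← e2, mul_comm] at e1
    exact (Nat.eq_of_mul_eq_mul_left Nat.card_pos e1).symm
  rw [← h1, h2, h3]
  refine Nat.card_congr ⟨fun x => ⟨x.1.1, by simpa [f] using congrArg Subtype.val x.2, x.1.2⟩,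
    fun c => ⟨⟨c.1, c.2.2⟩, Subtype.ext c.2.1⟩, fun _ => rfl, fun _ => rfl⟩

end TwoPowRank

/-! ### The signs as linear forms -/

section Signs

open NumberTheorySymbols

theorem signToF2_mul (u w : ℤˣ) : signToF2 (u * w) = signToF2 u + signToF2 w := by
  revert u w; decide

theorem signToF2_prod_pow {ι : Type*} (s : Finset ι) (u : ι → ℤˣ) (v : ι → ZMod 2) :
    signToF2 (∏ i ∈ s, u i ^ (v i).val) = ∑ i ∈ s, v i * signToF2 (u i) := by
  classical
  induction s using Finset.induction_on with
  | empty => simp [signToF2]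
  | insert i s hi ih =>
    rw [Finset.prod_insert hi, Finset.sum_insert hi, signToF2_mul, ih]
    congr 1
    generalize v i = a
    generalize u i = w
    revert a w
    decide

/-- The additive version of the Jacobi symbol `J(z | q)`. -/
def residueBit (q z : ℕ) : ZMod 2 := if J((z : ℤ) | q) = 1 then 0 else 1

theorem exists_unit_eq_jacobiSym {q z : ℕ} (h : IsCoprime (z : ℤ) q) :
    ∃ u : ℤˣ, (u : ℤ) = J((z : ℤ) | q) ∧ signToF2 u = residueBit q z := by
  rcases jacobiSym.eq_one_or_neg_one (Int.isCoprime_iff_gcd_eq_one.1 h) with h | h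
  · exact ⟨1, by simp [h], by simp [residueBit, signToF2, h]⟩
  · exact ⟨-1, by simp [h], by rw [residueBit, h]; decide⟩

theorem residueBit_mul {q z w : ℕ} (hz : IsCoprime (z : ℤ) q) (hw : IsCoprime (w : ℤ) q) :
    residueBit q (z * w) = residueBit q z + residueBit q w := by
  obtain ⟨u, hu, hu'⟩ := exists_unit_eq_jacobiSym hz
  obtain ⟨t, ht, ht'⟩ := exists_unit_eq_jacobiSym hw
  obtain ⟨r, hr, hr'⟩ := exists_unit_eq_jacobiSym (q := q) (z := z * w)
    (by push_cast; exact hz.mul_left hw)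
  have : r = u * t := by
    ext
    rw [hr, Units.val_mul, hu, ht, ← jacobiSym.mul_left]
    push_cast; rfl
  rw [← hu', ← ht', ← hr', this, signToF2_mul]

/-- For fixed $z$ the symbol is linear in $v$; its coefficients are in turn additive in $z$ by
`residueBit_mul`. -/
theorem signToF2_eq_sum {n : ℕ} {p : Fin (n + 1) → ℕ} (hp : ∀ i, (p i).Prime) {z : ℕ}
    (hz : ∀ i, IsCoprime (z : ℤ) (p i)) {u : ℤˣ} {v : Fin n → ZMod 2}
    (h : (u : ℤ) = J((z : ℤ) | toDivisor p v)) :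
    signToF2 u = ∑ i, v i * residueBit (p i.castSucc) z := by
  choose s hs hs' using fun i : Fin n => exists_unit_eq_jacobiSym (hz i.castSucc)
  have : u = ∏ i, s i ^ (v i).val := by
    ext
    rw [h, toDivisor, jacobiSym_prod_right _ _ _ fun i _ => pow_ne_zero _ (hp _).ne_zero,
      Units.coe_prod]
    refine Finset.prod_congr rfl fun i _ => ?_
    rw [jacobiSym.pow_right, Units.val_pow_eq_pow_val, hs]
  rw [this, signToF2_prod_pow]
  simp_rw [hs']

end Signs

/-! ### Divisors of the discriminant -/

section Divisors

variable {n : ℕ} {p : Fin (n + 1) → ℕ}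

theorem disc_neg (hp : ∀ i, (p i).Prime) : disc p < 0 :=
  neg_lt_zero.2 (Finset.prod_pos fun i _ => by exact_mod_cast (hp i).pos)

theorem dvd_disc (i : Fin (n + 1)) : (p i : ℤ) ∣ disc p :=
  (Finset.dvd_prod_of_mem (fun i => (p i : ℤ)) (Finset.mem_univ i)).neg_right

theorem exists_eq_of_dvd_disc (hp : ∀ i, (p i).Prime) {q : ℕ} (hq : q.Prime)
    (h : (q : ℤ) ∣ disc p) : ∃ i, p i = q := by
  rw [disc, dvd_neg, (Nat.prime_iff_prime_int.1 hq).dvd_finsetProd_iff] at h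
  obtain ⟨i, -, hi⟩ := h
  exact ⟨i, ((Nat.prime_dvd_prime_iff_eq hq (hp i)).1 (Int.natCast_dvd_natCast.1 hi)).symm⟩

theorem squarefree_disc (hp : ∀ i, (p i).Prime) (hinj : Function.Injective p) :
    Squarefree (disc p) := by
  rw [disc, ← Int.squarefree_natAbs, Int.natAbs_neg, ← Nat.cast_prod, Int.natAbs_natCast]
  refine Finset.squarefree_prod_of_pairwise_isCoprime (fun i _ j _ hij => ?_)
    fun i _ => (hp i).squarefree
  exact Nat.coprime_iff_isRelPrime.1 ((Nat.coprime_primes (hp i) (hp j)).2 (hinj.ne hij))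

theorem toDivisor_modEq (h1 : ∀ i : Fin n, p i.castSucc ≡ 1 [MOD 4]) (v : Fin n → ZMod 2) :
    toDivisor p v ≡ 1 [MOD 4] := by
  refine Finset.prod_induction _ (· ≡ 1 [MOD 4]) (fun a b ha hb => ?_) rfl fun i _ => ?_
  · simpa using ha.mul hb
  · simpa using (h1 i).pow (v i).val

theorem disc_eq (p : Fin (n + 1) → ℕ) :
    disc p = -((toDivisor p 1 : ℕ) * (p (Fin.last n) : ℤ)) := by
  rw [disc, Fin.prod_univ_castSucc, toDivisor]
  push_cast
  simp [ZMod.val_one_eq_one_mod]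

theorem disc_emod_four (h1 : ∀ i : Fin n, p i.castSucc ≡ 1 [MOD 4])
    (h3 : p (Fin.last n) ≡ 3 [MOD 4]) : disc p % 4 = 1 := by
  have h := (toDivisor_modEq h1 1).mul h3
  rw [Nat.ModEq] at h
  rw [disc_eq, ← Nat.cast_mul]
  omega

theorem toDivisor_dvd_disc (v : Fin n → ZMod 2) : (toDivisor p v : ℤ) ∣ disc p := by
  rw [disc_eq, dvd_neg, ← Nat.cast_mul]
  refine Int.natCast_dvd_natCast.2 (Dvd.dvd.mul_right (Finset.prod_dvd_prod_of_dvd _ _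
    fun i _ => pow_dvd_pow _ ?_) _)
  have := ZMod.val_lt (v i)
  simp only [Pi.one_apply, ZMod.val_one_eq_one_mod]
  omega

theorem emod_four_of_mem_primeFactors (hp : ∀ i, (p i).Prime)
    (h1 : ∀ i : Fin n, p i.castSucc ≡ 1 [MOD 4]) {v : Fin n → ZMod 2} {q : ℕ}
    (hq : q ∈ (toDivisor p v).primeFactors) : q % 4 = 1 := by
  have hqp := Nat.prime_of_mem_primeFactors hq
  obtain ⟨i, -, hi⟩ := hqp.prime.dvd_finsetProd_iff _ |>.1 (Nat.dvd_of_mem_primeFactors hq)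
  rw [(Nat.prime_dvd_prime_iff_eq hqp (hp _)).1 (hqp.dvd_of_dvd_pow hi)]
  exact h1 i

theorem squarefree_toDivisor (hp : ∀ i, (p i).Prime) (hinj : Function.Injective p)
    (v : Fin n → ZMod 2) : Squarefree (toDivisor p v) :=
  Int.squarefree_natCast.1 ((squarefree_disc hp hinj).squarefree_of_dvd (toDivisor_dvd_disc v))

theorem disc_ediv_emod_four (h1 : ∀ i : Fin n, p i.castSucc ≡ 1 [MOD 4])
    (h3 : p (Fin.last n) ≡ 3 [MOD 4]) (v : Fin n → ZMod 2) :
    disc p / (toDivisor p v : ℤ) % 4 = 1 := by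
  have h := disc_emod_four h1 h3
  have hD : toDivisor p v % 4 = 1 := toDivisor_modEq h1 v
  rw [← Int.mul_ediv_cancel' (toDivisor_dvd_disc v), Int.mul_emod,
    show (toDivisor p v : ℤ) % 4 = 1 by omega] at h
  omega

end Divisors

/-! ### The classes of the ideals whose squares are generated by divisors of the discriminant -/

section DivisorClass

variable {n : ℕ} {p : Fin (n + 1) → ℕ} {F : Type*} [Field F] [NumberField F]

/-- The ideal `∏ 𝔭ᵢ ^ vᵢ`, whose square is generated by `toDivisor p v`. -/
def divisorIdeal (F : Type*) [Field F] [NumberField F] (p : Fin (n + 1) → ℕ) (v : Fin n → ZMod 2) : Ideal (𝓞 F) :=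
  ∏ i : Fin n, primeAbove F (p i.castSucc) ^ (v i).val

theorem divisorClass_mul_sq_eq_one_iff (hp : ∀ i, (p i).Prime) {v : Fin n → ZMod 2}
    {J : nonZeroDivisors (Ideal (𝓞 F))} : divisorClass F p v * ClassGroup.mk0 J ^ 2 = 1 ↔
      (divisorIdeal F p v * (J : Ideal (𝓞 F)) ^ 2).IsPrincipal := by
  let P : Fin n → nonZeroDivisors (Ideal (𝓞 F)) := fun i =>
    ⟨primeAbove F (p i.castSucc), primeAbove_mem F (hp _).ne_zero⟩
  have h1 : divisorClass F p v = ClassGroup.mk0 (∏ i, P i ^ (v i).val) := by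
    rw [map_prod, divisorClass]
    refine Finset.prod_congr rfl fun i _ => ?_
    rw [map_pow, primeClass, dif_pos (hp _).ne_zero]
  have h2 : ((∏ i, P i ^ (v i).val : nonZeroDivisors (Ideal (𝓞 F))) : Ideal (𝓞 F)) =
      divisorIdeal F p v := by
    rw [SubmonoidClass.coe_finsetProd]
    rfl
  rw [h1, ← map_pow, ← map_mul, ClassGroup.mk0_eq_one_iff_isPrincipal, Submonoid.coe_mul, h2,
    SubmonoidClass.coe_pow]

namespace QuadraticConj

theorem divisorIdeal_sq (C : QuadraticConj F (disc p)) (hp : ∀ i, (p i).Prime)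
    (hinj : Function.Injective p) (v : Fin n → ZMod 2) :
    divisorIdeal F p v ^ 2 = Ideal.span {(toDivisor p v : 𝓞 F)} := by
  rw [divisorIdeal, ← Finset.prod_pow, toDivisor, Nat.cast_prod, ← Ideal.prod_span_singleton]
  refine Finset.prod_congr rfl fun i _ => ?_
  rw [← pow_mul, mul_comm, pow_mul, C.primeAbove_sq (squarefree_disc hp hinj) (hp _) (dvd_disc _),
    Ideal.span_singleton_pow, Nat.cast_pow]

theorem primeClass_sq (C : QuadraticConj F (disc p)) (hp : ∀ i, (p i).Prime)
    (hinj : Function.Injective p) (i : Fin (n + 1)) : primeClass F (p i) ^ 2 = 1 := by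
  rw [primeClass, dif_pos (hp i).ne_zero, ← map_pow, ClassGroup.mk0_eq_one_iff_isPrincipal,
    SubmonoidClass.coe_pow]
  exact ⟨_, C.primeAbove_sq (squarefree_disc hp hinj) (hp i) (dvd_disc i)⟩

theorem divisorClass_add (C : QuadraticConj F (disc p)) (hp : ∀ i, (p i).Prime)
    (hinj : Function.Injective p) (v w : Fin n → ZMod 2) :
    divisorClass F p (v + w) = divisorClass F p v * divisorClass F p w := by
  simp only [divisorClass]
  rw [← Finset.prod_mul_distrib]
  refine Finset.prod_congr rfl fun i _ => ?_
  rw [← pow_add, Pi.add_apply, ZMod.val_add, ← pow_eq_pow_mod _ (C.primeClass_sq hp hinj _)]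

/-- The product of all the ramified primes is $(\sqrt\Delta)$. This is why divisors of $p_1\cdots
p_{t-1}$ suffice: $\mathfrak p_t$ is redundant in the class group. -/
theorem prod_primeClass (C : QuadraticConj F (disc p)) (hp : ∀ i, (p i).Prime)
    (hinj : Function.Injective p) :
    divisorClass F p 1 * primeClass F (p (Fin.last n)) = 1 := by
  let P : Fin (n + 1) → nonZeroDivisors (Ideal (𝓞 F)) := fun i =>
    ⟨primeAbove F (p i), primeAbove_mem F (hp _).ne_zero⟩
  have hP : ∀ i, primeClass F (p i) = ClassGroup.mk0 (P i) := fun i => by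
    rw [primeClass, dif_pos (hp i).ne_zero]
  have h1 : divisorClass F p 1 * primeClass F (p (Fin.last n)) = ClassGroup.mk0 (∏ i, P i) := by
    rw [map_prod, Fin.prod_univ_castSucc, divisorClass, hP]
    congr 1
    refine Finset.prod_congr rfl fun i _ => ?_
    rw [hP]
    simp [ZMod.val_one_eq_one_mod]
  rw [h1, ClassGroup.mk0_eq_one_iff_isPrincipal, SubmonoidClass.coe_finsetProd]
  refine ⟨C.δ, pow_inj two_ne_zero ?_⟩
  rw [← Finset.prod_pow]
  refine (Finset.prod_congr rfl fun i _ =>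
    C.primeAbove_sq (squarefree_disc hp hinj) (hp i) (dvd_disc i)).trans ?_
  refine Eq.trans ?_ (Ideal.span_singleton_pow C.δ 2).symm
  rw [Ideal.prod_span_singleton, C.δ_sq, disc, Int.cast_neg, Ideal.span_singleton_neg]
  push_cast; rfl

theorem exists_divisorClass_eq (C : QuadraticConj F (disc p)) (hp : ∀ i, (p i).Prime)
    (hinj : Function.Injective p) {c : ClassGroup (𝓞 F)} (hc : c ^ 2 = 1) :
    ∃ v, divisorClass F p v = c := by
  let H : Subgroup (ClassGroup (𝓞 F)) :=
    { carrier := Set.range (divisorClass F p)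
      one_mem' := ⟨0, by simp [divisorClass]⟩
      mul_mem' := by
        rintro _ _ ⟨v, rfl⟩ ⟨w, rfl⟩
        exact ⟨v + w, C.divisorClass_add hp hinj v w⟩
      inv_mem' := by
        rintro _ ⟨v, rfl⟩
        refine ⟨v, eq_inv_of_mul_eq_one_left ?_⟩
        rw [← C.divisorClass_add hp hinj, show v + v = 0 from funext fun _ => CharTwo.add_self_eq_zero _]
        simp [divisorClass] }
  refine C.mem_of_sq_eq_one (disc_neg hp) (squarefree_disc hp hinj) H (fun q hq hqd => ?_) hc
  obtain ⟨i, rfl⟩ := exists_eq_of_dvd_disc hp hq hqd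
  induction i using Fin.lastCases with
  | last =>
    rw [eq_inv_of_mul_eq_one_right (C.prod_primeClass hp hinj)]
    exact H.inv_mem ⟨1, rfl⟩
  | cast i =>
    refine ⟨Pi.single i 1, ?_⟩
    rw [divisorClass, Finset.prod_eq_single i]
    · simp [ZMod.val_one_eq_one_mod]
    · intro j _ hj
      simp [Pi.single_eq_of_ne hj]
    · simp

end QuadraticConj

/-- The ideal `J` is prime to `2 Δ` and its class is a square root of the inverse of
`divisorClass F p v`. -/
def IsHalf (F : Type*) [Field F] [NumberField F] (p : Fin (n + 1) → ℕ) (v : Fin n → ZMod 2)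
    (J : nonZeroDivisors (Ideal (𝓞 F))) : Prop :=
  IsCoprime (J : Ideal (𝓞 F)) (Ideal.span {((2 * disc p : ℤ) : 𝓞 F)}) ∧
    divisorClass F p v * ClassGroup.mk0 J ^ 2 = 1

theorem exists_isCoprime_mk0_eq (hp : ∀ i, (p i).Prime) (c : ClassGroup (𝓞 F)) :
    ∃ J : nonZeroDivisors (Ideal (𝓞 F)), ClassGroup.mk0 J = c ∧
      IsCoprime (J : Ideal (𝓞 F)) (Ideal.span {((2 * disc p : ℤ) : 𝓞 F)}) := by
  refine exists_coprime_representative c ?_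
  have := disc_neg hp
  exact Int.cast_ne_zero.2 (by omega)

theorem exists_isHalf (hp : ∀ i, (p i).Prime) {v : Fin n → ZMod 2} (hv : v ∈ V₀ F p) :
    ∃ J, IsHalf F p v J := by
  obtain ⟨c, hc⟩ : divisorClass F p v ∈ powSubgroup (ClassGroup (𝓞 F)) 2 := hv
  obtain ⟨J, hJ, hcop⟩ := exists_isCoprime_mk0_eq hp c⁻¹
  refine ⟨J, hcop, ?_⟩
  rw [← hc, hJ]
  simp

/-- The quartic symbol of `Δ / D` modulo `D`, in additive notation. -/
def quarticForm (p : Fin (n + 1) → ℕ) (v : Fin n → ZMod 2) : ZMod 2 :=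
  signToF2 (quarticSymbolProd (disc p / (toDivisor p v : ℤ)) (toDivisor p v))

namespace IsHalf

variable {v w : Fin n → ZMod 2} {J K : nonZeroDivisors (Ideal (𝓞 F))}

theorem isCoprime (hp : ∀ i, (p i).Prime) (C : QuadraticConj F (disc p)) (h : IsHalf F p v J)
    (i : Fin (n + 1)) : IsCoprime (Ideal.absNorm (J : Ideal (𝓞 F)) : ℤ) (p i) :=
  (C.isCoprime_absNorm (disc_neg hp) h.1).of_mul_right_right.of_isCoprime_of_dvd_right (dvd_disc i)

theorem add (hp : ∀ i, (p i).Prime) (hinj : Function.Injective p) (C : QuadraticConj F (disc p))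
    (hv : IsHalf F p v J) (hw : IsHalf F p w K) : IsHalf F p (v + w) (J * K) := by
  refine ⟨hv.1.mul_left hw.1, ?_⟩
  rw [C.divisorClass_add hp hinj, map_mul, mul_pow, mul_mul_mul_comm, hv.2, hw.2, one_mul]

theorem isQuadraticResidue (hp : ∀ i, (p i).Prime) (hinj : Function.Injective p)
    (h1 : ∀ i : Fin n, p i.castSucc ≡ 1 [MOD 4]) (C : QuadraticConj F (disc p))
    (h : IsHalf F p v J) {q : ℕ} (hq : q ∈ (toDivisor p v).primeFactors) :
    IsQuadraticResidue (disc p / (toDivisor p v : ℤ)) q :=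
  C.isQuadraticResidue_of_isPrincipal (disc_neg hp)
    (Int.mul_ediv_cancel' (toDivisor_dvd_disc v)).symm (squarefree_toDivisor hp hinj v)
    (C.divisorIdeal_sq hp hinj v) h.1 ((divisorClass_mul_sq_eq_one_iff hp).1 h.2) hq
    (emod_four_of_mem_primeFactors hp h1 hq)

open NumberTheorySymbols in
theorem quarticSymbolProd_eq (hp : ∀ i, (p i).Prime) (hinj : Function.Injective p)
    (h1 : ∀ i : Fin n, p i.castSucc ≡ 1 [MOD 4]) (h3 : p (Fin.last n) ≡ 3 [MOD 4])
    (C : QuadraticConj F (disc p)) (h : IsHalf F p v J) :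
    (quarticSymbolProd (disc p / (toDivisor p v : ℤ)) (toDivisor p v) : ℤ) =
      J((Ideal.absNorm (J : Ideal (𝓞 F)) : ℤ) | toDivisor p v) :=
  C.quarticSymbolProd_of_isPrincipal (disc_neg hp)
    (Int.mul_ediv_cancel' (toDivisor_dvd_disc v)).symm (squarefree_toDivisor hp hinj v)
    (fun _ => emod_four_of_mem_primeFactors hp h1) (disc_ediv_emod_four h1 h3 v)
    (C.divisorIdeal_sq hp hinj v) h.1 ((divisorClass_mul_sq_eq_one_iff hp).1 h.2)

theorem quarticForm_eq (hp : ∀ i, (p i).Prime) (hinj : Function.Injective p)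
    (h1 : ∀ i : Fin n, p i.castSucc ≡ 1 [MOD 4]) (h3 : p (Fin.last n) ≡ 3 [MOD 4])
    (C : QuadraticConj F (disc p)) (h : IsHalf F p v J) :
    quarticForm p v =
      ∑ i, v i * residueBit (p i.castSucc) (Ideal.absNorm (J : Ideal (𝓞 F))) :=
  signToF2_eq_sum hp (h.isCoprime hp C) (h.quarticSymbolProd_eq hp hinj h1 h3 C)

/-- $JK$ is a valid choice for $v+w$; expanding the sum of $(v_i+w_i)$ times the added residue bits
leaves only the cross terms. -/
theorem polar_quarticForm (hp : ∀ i, (p i).Prime) (hinj : Function.Injective p)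
    (h1 : ∀ i : Fin n, p i.castSucc ≡ 1 [MOD 4]) (h3 : p (Fin.last n) ≡ 3 [MOD 4])
    (C : QuadraticConj F (disc p)) (hv : IsHalf F p v J) (hw : IsHalf F p w K) :
    QuadraticMap.polar (quarticForm p) v w =
      ∑ i, (v i * residueBit (p i.castSucc) (Ideal.absNorm (K : Ideal (𝓞 F))) +
        w i * residueBit (p i.castSucc) (Ideal.absNorm (J : Ideal (𝓞 F)))) := by
  rw [QuadraticMap.polar, (hv.add hp hinj C hw).quarticForm_eq hp hinj h1 h3 C,
    hv.quarticForm_eq hp hinj h1 h3 C, hw.quarticForm_eq hp hinj h1 h3 C,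
    ← Finset.sum_sub_distrib, ← Finset.sum_sub_distrib]
  refine Finset.sum_congr rfl fun i _ => ?_
  rw [Submonoid.coe_mul, map_mul, residueBit_mul (hv.isCoprime hp C _) (hw.isCoprime hp C _),
    Pi.add_apply]
  ring

theorem polar_quarticForm_add_left (hp : ∀ i, (p i).Prime) (hinj : Function.Injective p)
    (h1 : ∀ i : Fin n, p i.castSucc ≡ 1 [MOD 4]) (h3 : p (Fin.last n) ≡ 3 [MOD 4])
    (C : QuadraticConj F (disc p)) {u : Fin n → ZMod 2} {I : nonZeroDivisors (Ideal (𝓞 F))}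
    (hu : IsHalf F p u I) (hv : IsHalf F p v J) (hw : IsHalf F p w K) :
    QuadraticMap.polar (quarticForm p) (u + v) w =
      QuadraticMap.polar (quarticForm p) u w + QuadraticMap.polar (quarticForm p) v w := by
  rw [(hu.add hp hinj C hv).polar_quarticForm hp hinj h1 h3 C hw,
    hu.polar_quarticForm hp hinj h1 h3 C hw, hv.polar_quarticForm hp hinj h1 h3 C hw,
    ← Finset.sum_add_distrib]
  refine Finset.sum_congr rfl fun i _ => ?_
  rw [Submonoid.coe_mul, map_mul, residueBit_mul (hu.isCoprime hp C _) (hv.isCoprime hp C _),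
    Pi.add_apply]
  ring

end IsHalf

theorem quarticForm_zero (p : Fin (n + 1) → ℕ) : quarticForm p 0 = 0 := by
  simp [quarticForm, quarticSymbolProd, toDivisor, signToF2]

/-- If the class is $c^4$ and $J\in c^{-1}$, then $J^2$ is an admissible choice. Its norm is a
square, so every residue bit vanishes. -/
theorem quarticForm_eq_zero (hp : ∀ i, (p i).Prime) (hinj : Function.Injective p)
    (h1 : ∀ i : Fin n, p i.castSucc ≡ 1 [MOD 4]) (h3 : p (Fin.last n) ≡ 3 [MOD 4])
    (C : QuadraticConj F (disc p)) {v : Fin n → ZMod 2}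
    (hv : divisorClass F p v ∈ powSubgroup (ClassGroup (𝓞 F)) 4) : quarticForm p v = 0 := by
  obtain ⟨c, hc⟩ := hv
  obtain ⟨J, hJ, hcop⟩ := exists_isCoprime_mk0_eq hp c⁻¹
  have h : IsHalf F p v (J * J) := by
    refine ⟨hcop.mul_left hcop, ?_⟩
    rw [← hc, map_mul, hJ, ← sq, ← pow_mul]
    simp
  rw [h.quarticForm_eq hp hinj h1 h3 C]
  refine Finset.sum_eq_zero fun i _ => ?_
  have hi := (C.isCoprime_absNorm (disc_neg hp) hcop).of_mul_right_right.of_isCoprime_of_dvd_right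
    (dvd_disc i.castSucc)
  rw [Submonoid.coe_mul, map_mul, residueBit_mul hi hi, CharTwo.add_self_eq_zero, mul_zero]

/-- The quartic symbol as a quadratic form on `V₀`. -/
def quarticQuadraticForm (hp : ∀ i, (p i).Prime) (hinj : Function.Injective p)
    (h1 : ∀ i : Fin n, p i.castSucc ≡ 1 [MOD 4]) (h3 : p (Fin.last n) ≡ 3 [MOD 4])
    (C : QuadraticConj F (disc p)) : QuadraticForm (ZMod 2) (V₀ F p) :=
  QuadraticMap.ofPolar (fun v => quarticForm p v)
    (fun a v => by
      obtain rfl | rfl : a = 0 ∨ a = 1 := by revert a; decide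
      · simp [quarticForm_zero]
      · simp)
    (fun u v w => by
      obtain ⟨I, hI⟩ := exists_isHalf hp u.2
      obtain ⟨J, hJ⟩ := exists_isHalf hp v.2
      obtain ⟨K, hK⟩ := exists_isHalf hp w.2
      exact hI.polar_quarticForm_add_left hp hinj h1 h3 C hJ hK)
    (fun a v w => by
      obtain rfl | rfl : a = 0 ∨ a = 1 := by revert a; decide
      · simp [QuadraticMap.polar, quarticForm_zero]
      · simp)

/-- The subspace of `V₀` of those divisors whose ideal class is a fourth power. -/
def fourthPowerSubspace (C : QuadraticConj F (disc p)) (hp : ∀ i, (p i).Prime)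
    (hinj : Function.Injective p) : Submodule (ZMod 2) (V₀ F p) :=
  AddSubgroup.toZModSubmodule 2
    { carrier := {v | divisorClass F p v ∈ powSubgroup (ClassGroup (𝓞 F)) 4}
      zero_mem' := ⟨1, by simp [divisorClass]⟩
      add_mem' := fun {v w} hv hw => by
        simpa only [Set.mem_ofPred_eq, Submodule.coe_add, C.divisorClass_add hp hinj] using
          mul_mem hv hw
      neg_mem' := fun {v} hv => by
        rwa [show -v = v from ZModModule.neg_eq_self v] }

/-- A section of $v\mapsto$ `divisorClass F p v` over $\mathscr C[2]\cap4\mathscr C$ takes values in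
the subspace, and sections are injective. -/
theorem twoPowRank_le_finrank (C : QuadraticConj F (disc p)) (hp : ∀ i, (p i).Prime)
    (hinj : Function.Injective p) : twoPowRank (ClassGroup (𝓞 F)) 3 ≤
      Module.finrank (ZMod 2) (fourthPowerSubspace C hp hinj) := by
  rw [← Nat.pow_le_pow_iff_right (a := 2) one_lt_two, two_pow_twoPowRank]
  rw [← natCard_eq_two_pow_finrank]
  choose g hg using fun c : {c : ClassGroup (𝓞 F) // c ^ 2 = 1 ∧ c ∈ powSubgroup _ (2 ^ 2)} =>
    C.exists_divisorClass_eq hp hinj c.2.1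
  have hmem : ∀ c, g c ∈ V₀ F p := fun c => by
    obtain ⟨d, hd⟩ := c.2.2
    refine ⟨d ^ 2, ?_⟩
    rw [hg, ← hd]
    simp [← pow_mul]
  have hmem4 : ∀ c, (⟨g c, hmem c⟩ : V₀ F p) ∈ fourthPowerSubspace C hp hinj := fun c => by
    change divisorClass F p (g c) ∈ powSubgroup _ 4
    rw [hg]
    exact c.2.2
  refine Nat.card_le_card_of_injective
    (fun c => (⟨⟨g c, hmem c⟩, hmem4 c⟩ : fourthPowerSubspace C hp hinj)) fun c d hcd => ?_
  have : g c = g d := congrArg Subtype.val (congrArg Subtype.val hcd)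
  exact Subtype.ext (by rw [← hg c, ← hg d, this])

end DivisorClass

/-- The bound by $\dim W$ is essential: the supremum of an unbounded set of naturals is $0$ by
convention. -/
theorem finrank_le_isotropyIndex {k W : Type*} [Field k] [AddCommGroup W] [Module k W]
    [FiniteDimensional k W] {Q : QuadraticForm k W} {U : Submodule k W} (h : ∀ x ∈ U, Q x = 0) :
    Module.finrank k U ≤ isotropyIndex Q :=
  le_csSup ⟨Module.finrank k W, by rintro _ ⟨U, -, rfl⟩; exact U.finrank_le⟩ ⟨U, h, rfl⟩

theorem mainTheorem3 (n : ℕ) (p : Fin (n + 1) → ℕ)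
    (hp : ∀ i, (p i).Prime) (hinj : Function.Injective p)
    (h1 : ∀ i : Fin n, p i.castSucc ≡ 1 [MOD 4]) (h3 : p (Fin.last n) ≡ 3 [MOD 4])
    (F : Type*) [Field F] [NumberField F]
    (hdeg : Module.finrank ℚ F = 2) (hsqrt : ∃ s : F, s ^ 2 = (disc p : F)) :
    (∀ v ∈ V₀ F p, ∀ q ∈ (toDivisor p v).primeFactors,
      IsQuadraticResidue (disc p / (toDivisor p v : ℤ)) q) ∧
    ∃ Q : QuadraticForm (ZMod 2) (V₀ F p),
      (∀ v : V₀ F p, Q v = signToF2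
        (quarticSymbolProd (disc p / (toDivisor p (v : Fin n → ZMod 2) : ℤ))
          (toDivisor p (v : Fin n → ZMod 2)))) ∧
      twoPowRank (ClassGroup (𝓞 F)) 3 ≤ isotropyIndex Q ∧
      (twoPowRank (ClassGroup (𝓞 F)) 3 : ℝ) ≤
        Real.logb 2 (Nat.card {v : V₀ F p // Q v = 0} : ℝ) := by
  obtain ⟨C⟩ := exists_quadraticConj hdeg (squarefree_disc hp hinj) (disc_emod_four h1 h3)
    (disc_neg hp) hsqrt
  refine ⟨fun v hv q hq => ?_, quarticQuadraticForm hp hinj h1 h3 C, fun v => rfl, ?_, ?_⟩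
  · obtain ⟨J, hJ⟩ := exists_isHalf hp hv
    exact hJ.isQuadraticResidue hp hinj h1 C hq
  -- Both bounds use the same totally isotropic subspace: its dimension bounds the isotropy index
  -- from below, its cardinality the number of zeros.
  all_goals
    have hU : ∀ v ∈ fourthPowerSubspace C hp hinj,
        quarticQuadraticForm hp hinj h1 h3 C v = 0 :=
      fun v hv => quarticForm_eq_zero hp hinj h1 h3 C hv
    have hr := twoPowRank_le_finrank C hp hinj
  · exact hr.trans (finrank_le_isotropyIndex hU)
  · have hcard : 2 ^ twoPowRank (ClassGroup (𝓞 F)) 3 ≤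
        Nat.card {v : V₀ F p // quarticQuadraticForm hp hinj h1 h3 C v = 0} := by
      refine (Nat.pow_le_pow_right two_pos hr).trans ?_
      rw [← natCard_eq_two_pow_finrank]
      exact Nat.card_le_card_of_injective (fun v => ⟨v.1, hU v.1 v.2⟩) fun v w hvw =>
        Subtype.ext (Subtype.mk.inj hvw)
    rw [Real.le_logb_iff_rpow_le one_lt_two (by exact_mod_cast (pow_pos two_pos _).trans_le hcard),
      Real.rpow_natCast]
    exact_mod_cast hcard
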